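/- Let $p$ be a prime, $k$ a finite field of characteristic $p$, $W=W(k)$, $W_1=W/p^2W$, $\sigma$ the Frobenius of $W$ and $W_1$. Let $n$ be prime to $p$, let $r,l$ satisfy $l+1=rn$ and $p\nmid l$, and let $\mathbf f\in W[t]$ have degree $l$, be such that $\mathbf f,\mathbf f'$ generate the unit ideal of $W[t]$, and have reduction $f\in k[t]$ which still has degree $l$ and is prime to $t$. Put $\mathbf f_2(s)=s^{rn}\mathbf f(1/s)$, with reduction $f_2$. Let $X_0$ be the smooth projective curve over $k$ obtained by gluing $\mathcal U=\mathrm{Spec}\,k[t,y]/(y^n-f(t))$ and $\mathcal V=\mathrm{Spec}\,k[s,z]/(z^n-f_2(s))$ via $s=t^{-1}$, $z=t^{-r}y$. Put $\overline{\mathcal U}=\mathcal U\cap D(y)$, so that $X_0=\overline{\mathcal U}\cup\mathcal V$ and $\overline{\mathcal U}\cap\mathcal V=D(ty)$. With respect to this covering, $$H^1(X_0,\mathcal O)=\mathcal O(\overline{\mathcal U}\cap\mathcal V)/(\mathcal O(\overline{\mathcal U})+\mathcal O(\mathcal V)),$$ and $H^1_{DR}(X_0)$ is the space of triples $(\omega_U,\omega_V,h)\in\Omega^1(\overline{\mathcal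 U})\times\Omega^1(\mathcal V)\times\mathcal O(\overline{\mathcal U}\cap\mathcal V)$ with $\omega_V-\omega_U+dh=0$, modulo the triples $(da,db,a-b)$. Let $P_1:H^1_{DR}(X_0)\to H^1(X_0,\mathcal O)$, $[(\omega_U,\omega_V,h)]\mapsto\overline h$; it is the projection onto the factor $H^1(X_0,\mathcal O)$ for any splitting of the Hodge filtration of $H^1_{DR}(X_0)$. Let $X_0'$ be the twist of $X_0$ by the Frobenius of $k$, and $X_1$, $X_1'$ the lifts of $X_0$, $X_0'$ over $W_1$ defined by $\mathbf f$ and $\mathbf f^\sigma$. Let $v,b_0\in k[s]$ satisfy $$\mathbf f_2(s)^p-\mathbf f_2^{\sigma}(s^p)=p\left(v(s)f_2'(s)^p-n\,b_0(s)f_2(s)^p\right)\quad\text{in }W_1[s].$$ The relative Frobenius $F:X_0\to X_0'$ then lifts to $W_1$ over the two opens: over $\overline{\mathcal U}$ by $$F_U(t)=t^p,\qquad F_U(y)=y^p\left(1+\tfrac1n\left(\mathbf f^\sigma(t^p)-\mathbf f(t)^p\right)y^{-np}\right),$$ and over $\mathcal V$ by $$F_V(s)=s^p+p\,v(s),\qquad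 F_V(z)=z^p+p\,z^pb_0(s).$$ Let $f_U=F_U^*/p$ and $f_V=F_V^*/p$ be the divided Frobenius maps on $1$-forms of the twists of $\overline{\mathcal U}$ and $\mathcal V$, and let $h:\Omega^1_{X_0'}\to\mathcal O_{X_0}$ be the $F$-semilinear map over $\overline{\mathcal U}\cap\mathcal V$ determined by $p\,h(dx)=F_U(\tilde x)-F_V(\tilde x)$ for any lift $\tilde x$ of $x$ modulo $p^2$. The Deligne--Illusie morphism gives $$\Phi':H^0(X_0',\Omega^1)\oplus H^1(X_0',\mathcal O)\to H^1_{DR}(X_0),\qquad \Phi'(\omega)=[(f_U\omega,f_V\omega,h(\omega))],\quad \Phi'(\overline g)=[(0,0,F(g))],$$ and the divided Frobenius $\Phi$ on $H^0(X_0,\Omega^1)\oplus H^1(X_0,\mathcal O)$ is the composite of $\Phi'$ with the semilinear isomorphism induced by the projection $X_0'\to X_0$. Let $1\le j\le n-1$ and $0\le i\le rj-2$. There is a form $\omega_{i,j}\in H^0(X_0,\Omega^1)$ whose restriction to $\overline{\mathcal U}$ is $t^iy^{-j}dt$; let $\omega'_{i,j}=t^iy^{-j}dt$ on $X_0'$.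 Let $a$ and $b$ be the quotient and the remainder of the division of $pj$ by $n$, let $d=\max\{0,\deg v-2p\}$, let $I_d\in k[t]$ be an inverse of $f$ to order $d+1$ (that is, $t^{d+1}$ divides $fI_d-1$), and put $IP=I_d^{\,a+1}$. Write $IP[\kappa]$ and $v[m]$ for the coefficients of $t^\kappa$ in $IP$ and of $s^m$ in $v$. Then $1\le b\le n-1$, and in $H^1(X_0,\mathcal O)$ $$P_1(\Phi(\omega_{i,j}))=\overline{h(\omega'_{i,j})}=\sum_{m=1}^{r(n-b)-1}\left(\sum_{\kappa=0}^{\deg IP}IP[\kappa]\,v[p(i+2)+\kappa+m]\right)\overline{t^{-m}y^{n-b}}.$$ -/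

import Mathlib

open Polynomial
open scoped KaehlerDifferential


namespace Superelliptic

/-! ### Semilinear maps out of modules of differentials -/

section Semilinear

variable {k A B M : Type*} [CommRing k] [CommRing A] [Algebra k A] [CommRing B]
  [AddCommGroup M] [Module B M]

theorem exists_liftSemi (φ : A →+* B) (D : A →+ M)
    (hmul : ∀ x y, D (x * y) = φ x • D y + φ y • D x) (hk : ∀ c, D (algebraMap k A c) = 0) :
    ∃ g : Ω[A⁄k] →ₛₗ[φ] M, ∀ x, g (KaehlerDifferential.D k A x) = D x := by
  let _ : Module A M := Module.compHom M φ
  let _ : Module k M := Module.compHom M (φ.comp (algebraMap k A))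
  have hA : ∀ (a : A) (m : M), a • m = φ a • m := fun _ _ => rfl
  have hk' : ∀ (a : k) (m : M), a • m = φ (algebraMap k A a) • m := fun _ _ => rfl
  have : IsScalarTower k A M := ⟨fun c a m => by
    rw [hk', hA, hA, Algebra.smul_def, map_mul, mul_smul]⟩
  let D' : Derivation k A M := Derivation.mk'
    { toFun := D
      map_add' := map_add D
      map_smul' := fun c x => by
        simp only [RingHom.id_apply]
        rw [Algebra.smul_def, hmul, hk, smul_zero, add_zero, hk'] }
    (fun a b => by simpa [hA] using hmul a b)
  refine ⟨{ toFun := D'.liftKaehlerDifferential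
            map_add' := map_add _
            map_smul' := fun a m => by rw [map_smul, hA] }, fun x => ?_⟩
  exact D'.liftKaehlerDifferential_comp_D x

/-- The unique `φ`-semilinear map `Ω[A⁄k] → M` sending `dx` to `D x`, for an additive map `D`
which satisfies the Leibniz rule along `φ` and kills `k`. -/
noncomputable def liftSemi (φ : A →+* B) (D : A →+ M)
    (hmul : ∀ x y, D (x * y) = φ x • D y + φ y • D x) (hk : ∀ c, D (algebraMap k A c) = 0) :
    Ω[A⁄k] →ₛₗ[φ] M :=
  Classical.choose (exists_liftSemi φ D hmul hk)

theorem liftSemi_D (φ : A →+* B) (D : A →+ M)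
    (hmul : ∀ x y, D (x * y) = φ x • D y + φ y • D x) (hk : ∀ c, D (algebraMap k A c) = 0)
    (x : A) : liftSemi φ D hmul hk (KaehlerDifferential.D k A x) = D x :=
  Classical.choose_spec (exists_liftSemi φ D hmul hk) x

/-- Two additive maps which are semilinear along `φ` and agree on exact differentials are equal. -/
theorem addHom_ext (φ : A →+* B) (g h : Ω[A⁄k] →+ M) (hg : ∀ a w, g (a • w) = φ a • g w)
    (hh : ∀ a w, h (a • w) = φ a • h w)
    (H : ∀ x, g (KaehlerDifferential.D k A x) = h (KaehlerDifferential.D k A x)) (w : Ω[A⁄k]) :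
    g w = h w := by
  have hw : w ∈ Submodule.span A (Set.range (KaehlerDifferential.D k A)) := by
    rw [KaehlerDifferential.span_range_derivation]; trivial
  induction hw using Submodule.span_induction with
  | mem x hx => obtain ⟨y, rfl⟩ := hx; exact H y
  | zero => simp
  | add x y _ _ h1 h2 => rw [map_add, map_add, h1, h2]
  | smul a x _ h1 => rw [hg, hh, h1]

theorem leibniz_pow (φ : A →+* B) (D : A →+ M)
    (hmul : ∀ x y, D (x * y) = φ x • D y + φ y • D x) (x : A) (m : ℕ) :
    D (x ^ (m + 1)) = ((m + 1 : ℕ) : B) • φ x ^ m • D x := by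
  induction m with
  | zero => simp
  | succ m ih =>
    rw [pow_succ, hmul, ih, map_pow, smul_smul, smul_smul, smul_smul, ← add_smul]
    congr 1
    push_cast
    ring

/-- Over a perfect ring of characteristic `p`, constants are killed automatically. -/
theorem leibniz_const (p : ℕ) [Fact p.Prime] [CharP k p] [PerfectRing k p] (hp : (p : B) = 0)
    (φ : A →+* B) (D : A →+ M)
    (hmul : ∀ x y, D (x * y) = φ x • D y + φ y • D x) (c : k) : D (algebraMap k A c) = 0 := by
  obtain ⟨e, rfl⟩ := (PerfectRing.bijective_frobenius (R := k) (p := p)).2 c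
  obtain ⟨m, hm⟩ : ∃ m, p = m + 1 := ⟨p - 1, (Nat.succ_pred_prime Fact.out).symm⟩
  change D (algebraMap k A (e ^ p)) = 0
  rw [map_pow]
  have := leibniz_pow φ D hmul (algebraMap k A e) m
  rw [← hm, hp, zero_smul] at this
  exact this

variable [Algebra k B]

/-- Pull-back of differential forms `a dx ↦ φ(a) d(φ x)` along a ring morphism which carries
constants to constants. -/
noncomputable def omegaMap (φ : A →+* B)
    (hφ : ∀ c : k, ∃ c' : k, φ (algebraMap k A c) = algebraMap k B c') :
    Ω[A⁄k] →ₛₗ[φ] Ω[B⁄k] :=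
  liftSemi φ ((KaehlerDifferential.D k B).toLinearMap.toAddMonoidHom.comp φ.toAddMonoidHom)
    (fun x y => by simp)
    (fun c => by obtain ⟨c', h⟩ := hφ c; simp [h])

theorem omegaMap_D (φ : A →+* B)
    (hφ : ∀ c : k, ∃ c' : k, φ (algebraMap k A c) = algebraMap k B c') (x : A) :
    omegaMap φ hφ (KaehlerDifferential.D k A x) = KaehlerDifferential.D k B (φ x) :=
  liftSemi_D ..

/-- The restriction of differential forms along a morphism of `k`-algebras, as a `k`-linear map. -/
noncomputable def resOmega (φ : A →ₐ[k] B) : Ω[A⁄k] →ₗ[k] Ω[B⁄k] where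
  toFun := omegaMap (φ : A →+* B) (fun c => ⟨c, by simp⟩)
  map_add' := map_add _
  map_smul' c w := by
    rw [← algebraMap_smul A c w, LinearMap.map_smulₛₗ]
    simp

theorem resOmega_D (φ : A →ₐ[k] B) (x : A) :
    resOmega φ (KaehlerDifferential.D k A x) = KaehlerDifferential.D k B (φ x) := by
  change omegaMap (φ : A →+* B) _ _ = _
  rw [omegaMap_D, RingHom.coe_coe]

theorem resOmega_smul (φ : A →ₐ[k] B) (a : A) (w : Ω[A⁄k]) :
    resOmega φ (a • w) = φ a • resOmega φ w :=
  (omegaMap (φ : A →+* B) (fun c => ⟨c, by simp⟩)).map_smulₛₗ a w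

end Semilinear

/-! ### Čech cohomology of a curve covered by two affine opens

The curve is covered by two affine opens with rings of functions `AU` and `AV`, and `B` is the ring
of functions on their intersection. -/

section Cech

variable {k AU AV B : Type*} [CommRing k] [CommRing AU] [Algebra k AU] [CommRing AV] [Algebra k AV]
  [CommRing B] [Algebra k B] (rU : AU →ₐ[k] B) (rV : AV →ₐ[k] B)

/-- The universal differential, as a `k`-linear map. -/
noncomputable abbrev dR (k A : Type*) [CommRing k] [CommRing A] [Algebra k A] : A →ₗ[k] Ω[A⁄k] :=
  (KaehlerDifferential.D k A).toLinearMap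

/-- `H⁰(Ω¹)`: pairs of differential forms which agree on the intersection. -/
noncomputable def H0Omega : Submodule k (Ω[AU⁄k] × Ω[AV⁄k]) :=
  LinearMap.ker ((resOmega rU).comp (LinearMap.fst k _ _) -
    (resOmega rV).comp (LinearMap.snd k _ _))

/-- The Čech differential `(a, b) ↦ a - b` of the structure sheaf. -/
noncomputable def cechO : AU × AV →ₗ[k] B :=
  rU.toLinearMap.comp (LinearMap.fst k _ _) - rV.toLinearMap.comp (LinearMap.snd k _ _)

/-- `H¹(O)`: the functions on the intersection modulo the image of the Čech differential. -/
abbrev H1O : Type _ := B ⧸ LinearMap.range (cechO rU rV)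

/-- The class in `H¹(O)` of a function on the intersection. -/
noncomputable abbrev classO : B →ₗ[k] H1O rU rV := (LinearMap.range (cechO rU rV)).mkQ

/-- First differential `(a, b) ↦ (da, db, a - b)` of the Čech-de Rham complex. -/
noncomputable def dRd0 : AU × AV →ₗ[k] (Ω[AU⁄k] × Ω[AV⁄k]) × B :=
  (((dR k AU).comp (LinearMap.fst k _ _)).prod ((dR k AV).comp (LinearMap.snd k _ _))).prod
    (cechO rU rV)

/-- Second differential `(ω, η, h) ↦ η - ω + dh` of the Čech-de Rham complex. -/
noncomputable def dRd1 : (Ω[AU⁄k] × Ω[AV⁄k]) × B →ₗ[k] Ω[B⁄k] :=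
  ((resOmega rV).comp (LinearMap.snd k _ _) -
    (resOmega rU).comp (LinearMap.fst k _ _)).comp (LinearMap.fst k _ _) +
    (dR k B).comp (LinearMap.snd k _ _)

/-- The 1-cocycles of the Čech-de Rham complex. -/
noncomputable abbrev dRZ1 : Submodule k ((Ω[AU⁄k] × Ω[AV⁄k]) × B) := LinearMap.ker (dRd1 rU rV)

/-- `H¹_DR`: the 1-cocycles of the Čech-de Rham complex modulo the 1-coboundaries. -/
abbrev H1dR : Type _ :=
  dRZ1 rU rV ⧸ (LinearMap.range (dRd0 rU rV)).comap (dRZ1 rU rV).subtype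

/-- The class of a 1-cocycle. -/
noncomputable abbrev classDR : dRZ1 rU rV →ₗ[k] H1dR rU rV :=
  ((LinearMap.range (dRd0 rU rV)).comap (dRZ1 rU rV).subtype).mkQ

theorem mem_H0Omega {w : Ω[AU⁄k] × Ω[AV⁄k]} :
    w ∈ H0Omega rU rV ↔ resOmega rU w.1 = resOmega rV w.2 := by
  simp [H0Omega, sub_eq_zero]

theorem mem_dRZ1 {w : (Ω[AU⁄k] × Ω[AV⁄k]) × B} :
    w ∈ dRZ1 rU rV ↔
      resOmega rV w.1.2 - resOmega rU w.1.1 + KaehlerDifferential.D k B w.2 = 0 := by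
  simp [dRZ1, dRd1]

/-- `dRd0` followed by `dRd1` is zero. -/
theorem dRd1_dRd0 (x : AU × AV) : dRd1 rU rV (dRd0 rU rV x) = 0 := by
  simp [dRd1, dRd0, cechO, resOmega_D]

/-- The inclusion `H⁰(Ω¹) → H¹_DR`, `ω ↦ [(ω|U, ω|V, 0)]`. -/
noncomputable def hodgeIncl : H0Omega rU rV →ₗ[k] H1dR rU rV :=
  (classDR rU rV).comp
    (((LinearMap.inl k _ _).comp (H0Omega rU rV).subtype).codRestrict (dRZ1 rU rV) (fun w => by
      have := (mem_H0Omega rU rV).1 w.2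
      rw [mem_dRZ1]
      simp [this]))

/-- The projection `H¹_DR → H¹(O)`, `[(ω, η, h)] ↦ [h]`. -/
noncomputable def hodgeProj : H1dR rU rV →ₗ[k] H1O rU rV :=
  Submodule.mapQ _ _ ((LinearMap.snd k _ _).comp (dRZ1 rU rV).subtype) (by
    rintro ⟨_, _⟩ ⟨x, rfl⟩
    exact ⟨x, rfl⟩)

theorem hodgeProj_classDR (z : dRZ1 rU rV) :
    hodgeProj rU rV (classDR rU rV z) = classO rU rV z.1.2 := rfl

/-- For every splitting `τ` of the Hodge filtration, `hodgeProj` is the projection on the second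
factor of `H⁰(Ω¹) ⊕ H¹(O)`, identified with `H¹_DR` by `(ω, x) ↦ ω + τ x`. -/
theorem hodgeProj_incl_add (τ : H1O rU rV →ₗ[k] H1dR rU rV)
    (hτ : ∀ x, hodgeProj rU rV (τ x) = x) (w : H0Omega rU rV) (x : H1O rU rV) :
    hodgeProj rU rV (hodgeIncl rU rV w + τ x) = x := by
  rw [map_add, hτ]
  have : hodgeProj rU rV (hodgeIncl rU rV w) = 0 := by
    change hodgeProj rU rV (classDR rU rV _) = 0
    rw [hodgeProj_classDR]
    simp
  rw [this, zero_add]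

end Cech


/-! ### Reduction modulo `p` of rings which are flat over `W / p²` -/

section Reduction

variable {A B : Type*} [CommRing A] [CommRing B]

/-- `red : A → B` is the reduction modulo `p` of a ring `A` in which `p² = 0` and which is flat over
`ℤ / p²`: it identifies `B` with `A / pA`, and multiplication by `p` identifies `B` with `pA`. -/
structure IsReduction (p : ℕ) (red : A →+* B) : Prop where
  surj : Function.Surjective red
  ker : ∀ a, red a = 0 ↔ ∃ b, a = p * b
  tors : ∀ a, red a = 0 ↔ (p : A) * a = 0

open Classical in
/-- Division by `p`: the element `p a` of `pA` is sent to `red a` (and elements outside `pA`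
to `0`). -/
noncomputable def divP (p : ℕ) (red : A →+* B) (x : A) : B :=
  if h : ∃ a, x = p * a then red h.choose else 0

/-- Multiplication by `p` on `B`, as a map `B → pA`: `p` times any lift. -/
noncomputable def mulP (p : ℕ) (red : A →+* B) (b : B) : A := p * Function.invFun red b

variable {p : ℕ} {red : A →+* B}

theorem IsReduction.mul_congr (H : IsReduction p red) {a b : A} (h : red a = red b) : (p : A) * a = p * b := by
  rw [← sub_eq_zero, ← mul_sub, ← H.tors, map_sub, h, sub_self]

theorem IsReduction.divP_mul (H : IsReduction p red) (a : A) : divP p red (p * a) = red a := by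
  have h : ∃ b, (p : A) * a = p * b := ⟨a, rfl⟩
  rw [divP, dif_pos h]
  have := h.choose_spec
  rw [← sub_eq_zero, ← mul_sub, ← H.tors, map_sub, sub_eq_zero] at this
  exact this.symm

theorem IsReduction.mulP_red (H : IsReduction p red) (a : A) : mulP p red (red a) = p * a :=
  H.mul_congr (Function.invFun_eq ⟨a, rfl⟩)

theorem IsReduction.red_p (H : IsReduction p red) : red (p : A) = 0 := (H.ker _).2 ⟨1, by simp⟩

theorem IsReduction.p_eq_zero (H : IsReduction p red) : (p : B) = 0 := by simpa using H.red_p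

theorem IsReduction.p_sq (H : IsReduction p red) : (p : A) * p = 0 := (H.tors _).1 H.red_p

theorem IsReduction.exists_of_red_eq (H : IsReduction p red) {a b : A} (h : red a = red b) : ∃ c, a = b + p * c := by
  obtain ⟨c, hc⟩ := (H.ker (a - b)).1 (by rw [map_sub, h, sub_self])
  exact ⟨c, by rw [← hc]; ring⟩

theorem IsReduction.divP_add (H : IsReduction p red) {x y : A} (hx : red x = 0) (hy : red y = 0) :
    divP p red (x + y) = divP p red x + divP p red y := by
  obtain ⟨a, rfl⟩ := (H.ker x).1 hx
  obtain ⟨b, rfl⟩ := (H.ker y).1 hy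
  rw [← mul_add, H.divP_mul, H.divP_mul, H.divP_mul, map_add]

theorem IsReduction.divP_smul (H : IsReduction p red) (c : A) {x : A} (hx : red x = 0) :
    divP p red (c * x) = red c * divP p red x := by
  obtain ⟨a, rfl⟩ := (H.ker x).1 hx
  rw [mul_left_comm, H.divP_mul, H.divP_mul, map_mul]

theorem IsReduction.pow_p_congr (H : IsReduction p red) {a b : A} (h : red a = red b) : a ^ p = b ^ p := by
  obtain ⟨c, rfl⟩ := H.exists_of_red_eq h
  have := Polynomial.eval_add_of_sq_eq_zero (X ^ p : A[X]) b (p * c)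
    (by rw [mul_pow, sq, H.p_sq, zero_mul])
  simp only [eval_pow, eval_X, derivative_X_pow, eval_mul, eval_C] at this
  rw [this]
  have h2 : (p : A) * b ^ (p - 1) * (p * c) = (p * p) * (b ^ (p - 1) * c) := by ring
  simp [h2, H.p_sq]

/-- Reduction of polynomial rings. -/
theorem IsReduction.polynomial (H : IsReduction p red) : IsReduction p (Polynomial.mapRingHom red) where
  surj := Polynomial.map_surjective _ H.surj
  ker f := by
    constructor
    · intro h
      have hc : ∀ i, ∃ b, f.coeff i = p * b := fun i => (H.ker _).1 (by
        have := congrArg (fun g => coeff g i) h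
        simpa using this)
      choose b hb using hc
      refine ⟨∑ i ∈ f.support, monomial i (b i), ?_⟩
      rw [Finset.mul_sum]
      conv_lhs => rw [f.as_sum_support]
      refine Finset.sum_congr rfl fun i _ => ?_
      rw [hb, ← C_eq_natCast, C_mul_monomial]
    · rintro ⟨g, rfl⟩
      rw [map_mul, map_natCast, ← C_eq_natCast, H.p_eq_zero, C_0, zero_mul]
  tors f := by
    constructor
    · intro h
      ext i
      rw [← C_eq_natCast, coeff_C_mul, coeff_zero, ← H.tors]
      have := congrArg (fun g => coeff g i) h
      simpa using this
    · intro h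
      ext i
      have := congrArg (fun g => coeff g i) h
      simp only [← C_eq_natCast, coeff_C_mul, coeff_zero] at this
      simpa using (H.tors _).2 this

/-- Reduction of monogenic extensions. -/
theorem IsReduction.adjoinRoot (H : IsReduction p red) (g : A[X]) (hg : g.Monic) (g' : B[X]) (hgg : g.map red = g')
    (φ : AdjoinRoot g →+* AdjoinRoot g')
    (hφ : ∀ f, φ (AdjoinRoot.mk g f) = AdjoinRoot.mk g' (f.map red)) : IsReduction p φ := by
  have P := H.polynomial
  have key : ∀ f : A[X], φ (AdjoinRoot.mk g f) = 0 ↔ (f %ₘ g).map red = 0 := by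
    intro f
    have hg' : g'.Monic := hgg ▸ hg.map red
    rw [hφ, AdjoinRoot.mk_eq_zero, ← Polynomial.modByMonic_eq_zero_iff_dvd hg', ← hgg,
      Polynomial.map_modByMonic _ hg]
  have hmk : ∀ f : A[X], AdjoinRoot.mk g f = AdjoinRoot.mk g (f %ₘ g) := by
    intro f
    rw [AdjoinRoot.mk_eq_mk]
    exact ⟨f /ₘ g, by linear_combination -(Polynomial.modByMonic_add_div f g)⟩
  refine ⟨?_, ?_, ?_⟩
  · intro b
    obtain ⟨b, rfl⟩ := AdjoinRoot.mk_surjective b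
    obtain ⟨a, rfl⟩ := Polynomial.map_surjective _ H.surj b
    exact ⟨AdjoinRoot.mk g a, hφ a⟩
  · intro a
    constructor
    · obtain ⟨f, rfl⟩ := AdjoinRoot.mk_surjective a
      intro h
      obtain ⟨q, hq⟩ := (P.ker _).1 ((key f).1 h)
      exact ⟨AdjoinRoot.mk g q, by rw [hmk f, hq]; simp⟩
    · rintro ⟨b, rfl⟩
      obtain ⟨f, rfl⟩ := AdjoinRoot.mk_surjective b
      rw [map_mul, hφ, map_natCast]
      have : ((p : B[X])) = 0 := P.p_eq_zero
      have h2 : ((p : AdjoinRoot g')) = 0 := by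
        rw [← map_natCast (AdjoinRoot.mk g'), this, map_zero]
      rw [h2, zero_mul]
  · intro a
    obtain ⟨f, rfl⟩ := AdjoinRoot.mk_surjective a
    rw [key]
    change mapRingHom red (f %ₘ g) = 0 ↔ _
    rw [P.tors]
    have : (p : AdjoinRoot g) * AdjoinRoot.mk g f = AdjoinRoot.mk g (p * f) := by simp
    rw [this, AdjoinRoot.mk_eq_zero, ← Polynomial.modByMonic_eq_zero_iff_dvd hg,
      ← C_eq_natCast, ← smul_eq_C_mul, ← smul_eq_C_mul, Polynomial.smul_modByMonic]

/-- Reduction of localizations at one element. -/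
theorem IsReduction.localization (H : IsReduction p red) (e : A) (e' : B) (he : red e = e') {A' B' : Type*} [CommRing A']
    [CommRing B'] [Algebra A A'] [Algebra B B'] [IsLocalization.Away e A']
    [IsLocalization.Away e' B'] (φ : A' →+* B')
    (hφ : ∀ a, φ (algebraMap A A' a) = algebraMap B B' (red a)) : IsReduction p φ := by
  subst he
  have hu : ∀ n : ℕ, IsUnit (algebraMap A A' (e ^ n)) := fun n => by
    rw [map_pow]; exact (IsLocalization.Away.algebraMap_isUnit e).pow n
  have hu' : ∀ n : ℕ, IsUnit (algebraMap B B' (red e ^ n)) := fun n => by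
    rw [map_pow]; exact (IsLocalization.Away.algebraMap_isUnit (red e)).pow n
  have key : ∀ a, φ (algebraMap A A' a) = 0 ↔ ∃ n : ℕ, red (e ^ n * a) = 0 := by
    intro a
    rw [hφ, IsLocalization.map_eq_zero_iff (Submonoid.powers (red e))]
    constructor
    · rintro ⟨⟨_, n, rfl⟩, h⟩
      exact ⟨n, by simpa using h⟩
    · rintro ⟨n, h⟩
      exact ⟨⟨_, n, rfl⟩, by simpa using h⟩
  have hsurj : ∀ x : A', ∃ a, ∃ n : ℕ, x * algebraMap A A' (e ^ n) = algebraMap A A' a := by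
    intro x
    obtain ⟨⟨a, ⟨_, n, rfl⟩⟩, h⟩ := IsLocalization.surj (Submonoid.powers e) x
    exact ⟨a, n, h⟩
  have hp0 : (p : B') = 0 := by
    rw [← map_natCast (algebraMap B B'), H.p_eq_zero, map_zero]
  refine ⟨?_, ?_, ?_⟩
  · intro y
    obtain ⟨⟨b, ⟨_, n, rfl⟩⟩, h⟩ := IsLocalization.surj (Submonoid.powers (red e)) y
    obtain ⟨a, rfl⟩ := H.surj b
    obtain ⟨u, hu1⟩ := hu n
    refine ⟨algebraMap A A' a * ↑u⁻¹, (hu' n).mul_right_cancel ?_⟩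
    rw [h, ← map_pow, ← hφ, ← map_mul, mul_assoc, ← hu1, Units.inv_mul, mul_one, hφ]
  · intro x
    constructor
    · intro hx
      obtain ⟨a, n, h⟩ := hsurj x
      obtain ⟨m, hm⟩ := (key a).1 (by rw [← h, map_mul, hx, zero_mul])
      obtain ⟨b, hb⟩ := (H.ker _).1 hm
      obtain ⟨u, hu1⟩ := hu (m + n)
      refine ⟨algebraMap A A' b * ↑u⁻¹, (hu (m + n)).mul_right_cancel ?_⟩
      rw [mul_assoc, mul_assoc, ← hu1, Units.inv_mul, mul_one, hu1, pow_add, map_mul, mul_left_comm,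
        h, ← map_mul, hb, map_mul, map_natCast]
    · rintro ⟨b, rfl⟩
      rw [map_mul, map_natCast, hp0, zero_mul]
  · intro x
    obtain ⟨a, n, h⟩ := hsurj x
    have h1 : φ x = 0 ↔ φ (algebraMap A A' a) = 0 := by
      rw [← h, map_mul, ((hu n).map φ).mul_left_eq_zero]
    have h2 : (p : A') * x = 0 ↔ algebraMap A A' (p * a) = 0 := by
      rw [map_mul, ← h, map_natCast, ← mul_assoc, (hu n).mul_left_eq_zero]
    rw [h1, h2, key, IsLocalization.map_eq_zero_iff (Submonoid.powers e)]
    constructor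
    · rintro ⟨m, hm⟩
      refine ⟨⟨_, m, rfl⟩, ?_⟩
      rw [H.tors] at hm
      rw [mul_left_comm]
      exact hm
    · rintro ⟨⟨_, m, rfl⟩, hm⟩
      refine ⟨m, ?_⟩
      rw [H.tors, mul_left_comm]
      exact hm

end Reduction

/-! ### The Deligne-Illusie construction on an affine open -/

section Binomial

variable {k A : Type*} [CommRing k] [CommRing A] [Algebra k A]

/-- The polynomial `((x + y)^p - x^p - y^p) / p`. -/
noncomputable def binom (p : ℕ) (x y : A) : A :=
  ∑ i ∈ Finset.Ioo 0 p, x ^ i * y ^ (p - i) * ((p.choose i / p : ℕ) : A)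

theorem binom_sum (p : ℕ) [hp : Fact p.Prime] (x y : A) :
    ∑ i ∈ Finset.Ioo 0 p, ((p.choose i / p * i : ℕ) : A) * x ^ (i - 1) * y ^ (p - i) =
      (x + y) ^ (p - 1) - x ^ (p - 1) := by
  obtain ⟨q, rfl⟩ : ∃ q, p = q + 1 := ⟨p - 1, (Nat.succ_pred_prime hp.out).symm⟩
  have h1 : ∀ i ∈ Finset.range q, (q + 1).choose (i + 1) / (q + 1) * (i + 1) = q.choose i := by
    intro i hi
    have hi' : i < q := Finset.mem_range.1 hi
    obtain ⟨c, hc⟩ := hp.out.dvd_choose_self (k := i + 1) (by omega) (by omega)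
    have h2 := Nat.add_one_mul_choose_eq q i
    rw [hc] at h2 ⊢
    rw [Nat.mul_div_cancel_left _ (Nat.succ_pos q)]
    rw [mul_assoc] at h2
    exact (Nat.eq_of_mul_eq_mul_left (Nat.succ_pos q) h2).symm
  have h3 : Finset.Ioo 0 (q + 1) = (Finset.range q).map ⟨(· + 1), add_left_injective 1⟩ := by
    ext i
    simp only [Finset.mem_Ioo, Finset.mem_map, Finset.mem_range, Function.Embedding.coeFn_mk]
    constructor
    · rintro ⟨h, h'⟩
      exact ⟨i - 1, by omega, by omega⟩
    · rintro ⟨j, hj, rfl⟩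
      omega
  rw [h3, Finset.sum_map, Nat.add_sub_cancel, add_pow, Finset.sum_range_succ]
  simp only [Function.Embedding.coeFn_mk, Nat.sub_self, pow_zero, mul_one, Nat.choose_self,
    Nat.cast_one, add_sub_cancel_right]
  refine Finset.sum_congr rfl fun i hi => ?_
  rw [h1 i hi, Nat.add_sub_add_right, Nat.add_sub_add_right, Nat.sub_zero]
  ring

theorem binom_comm (p : ℕ) (x y : A) : binom p x y = binom p y x := by
  refine Finset.sum_bij' (fun i _ => p - i) (fun i _ => p - i) ?_ ?_ ?_ ?_ ?_
  · intro i hi; simp only [Finset.mem_Ioo] at hi ⊢; omega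
  · intro i hi; simp only [Finset.mem_Ioo] at hi ⊢; omega
  · intro i hi; simp only [Finset.mem_Ioo] at hi; omega
  · intro i hi; simp only [Finset.mem_Ioo] at hi; omega
  · intro i hi
    simp only [Finset.mem_Ioo] at hi
    rw [Nat.choose_symm hi.2.le, Nat.sub_sub_self hi.2.le]
    ring

theorem add_pow_binom (p : ℕ) [hp : Fact p.Prime] (x y : A) :
    (x + y) ^ p = x ^ p + y ^ p + p * binom p x y :=
  add_pow_prime_eq' hp.out x y

theorem D_binom (p : ℕ) [hp : Fact p.Prime] (x y : A) :
    KaehlerDifferential.D k A (binom p x y) =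
      ((x + y) ^ (p - 1) - x ^ (p - 1)) • KaehlerDifferential.D k A x +
      ((x + y) ^ (p - 1) - y ^ (p - 1)) • KaehlerDifferential.D k A y := by
  have h2 : ∑ i ∈ Finset.Ioo 0 p, ((p.choose i / p * (p - i) : ℕ) : A) * x ^ i * y ^ (p - i - 1) =
      (x + y) ^ (p - 1) - y ^ (p - 1) := by
    rw [add_comm x y, ← binom_sum p y x]
    refine Finset.sum_bij' (fun i _ => p - i) (fun i _ => p - i) ?_ ?_ ?_ ?_ ?_
    · intro i hi; simp only [Finset.mem_Ioo] at hi ⊢; omega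
    · intro i hi; simp only [Finset.mem_Ioo] at hi ⊢; omega
    · intro i hi; simp only [Finset.mem_Ioo] at hi; omega
    · intro i hi; simp only [Finset.mem_Ioo] at hi; omega
    · intro i hi
      simp only [Finset.mem_Ioo] at hi
      rw [Nat.choose_symm hi.2.le, Nat.sub_sub_self hi.2.le]
      ring
  rw [← binom_sum p x y, ← h2, binom, map_sum, Finset.sum_smul, Finset.sum_smul,
    ← Finset.sum_add_distrib]
  refine Finset.sum_congr rfl fun i _ => ?_
  rw [Derivation.leibniz, Derivation.map_natCast, smul_zero, zero_add, Derivation.leibniz,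
    Derivation.leibniz_pow, Derivation.leibniz_pow]
  simp only [← Nat.cast_smul_eq_nsmul A, smul_add, smul_smul]
  rw [add_comm]
  push_cast
  congr 2 <;> ring

end Binomial

/-- An affine open of the curve, together with everything needed to lift Frobenius over it.
`A1` is the ring of functions modulo `p²` and `A0` its reduction modulo `p`, a `k`-algebra; `A1'` and
`A0'` are the analogues for the Frobenius twist of the curve; `pr1` and `pr0` are the projections
from the twist (on functions), and `frob` is the relative Frobenius. -/
structure FrobSetting (p : ℕ) (k A1' A0' A1 A0 : Type*) [Field k] [CommRing A1'] [CommRing A0']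
    [CommRing A1] [CommRing A0] [Algebra k A0'] [Algebra k A0] where
  red' : A1' →+* A0'
  red : A1 →+* A0
  pr1 : A1 →+* A1'
  pr0 : A0 ≃+* A0'
  frob : A0' →+* A0
  isRed' : IsReduction p red'
  isRed : IsReduction p red
  red'_pr1 : ∀ x, red' (pr1 x) = pr0 (red x)
  frob_pr0 : ∀ x, frob (pr0 x) = x ^ p
  pr0_const : ∀ c : k, pr0 (algebraMap k A0 c) = algebraMap k A0' (c ^ p)
  frob_const : ∀ c : k, frob (algebraMap k A0' c) = algebraMap k A0 c

namespace FrobSetting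

variable {p : ℕ} {k A1' A0' A1 A0 : Type*} [Field k] [CommRing A1'] [CommRing A0']
    [CommRing A1] [CommRing A0] [Algebra k A0'] [Algebra k A0]

/-- A lift modulo `p²` of the relative Frobenius. -/
structure Lift (S : FrobSetting p k A1' A0' A1 A0) where
  F : A1' →+* A1
  red_F : ∀ x, S.red (F x) = S.frob (S.red' x)

variable (S : FrobSetting p k A1' A0' A1 A0) (L M : S.Lift)

/-- The function `u` with `F(x') = x ^ p + p u`, where `x'` is the image of `x` in the twist. -/
noncomputable def Lift.delta {S : FrobSetting p k A1' A0' A1 A0} (L : S.Lift) (x : A1) : A0 :=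
  divP p S.red (L.F (S.pr1 x) - x ^ p)

theorem Lift.F_pr1 {S : FrobSetting p k A1' A0' A1 A0} (L : S.Lift) (x : A1) :
    ∃ u, S.red u = L.delta x ∧ L.F (S.pr1 x) = x ^ p + p * u := by
  have h0 : S.red (L.F (S.pr1 x)) = S.red (x ^ p) := by
    rw [L.red_F, S.red'_pr1, S.frob_pr0, map_pow]
  obtain ⟨u, hu⟩ := S.isRed.exists_of_red_eq h0
  exact ⟨u, by rw [Lift.delta, hu, add_sub_cancel_left, S.isRed.divP_mul], hu⟩

theorem Lift.delta_eq {S : FrobSetting p k A1' A0' A1 A0} (L : S.Lift) {x u : A1}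
    (h : L.F (S.pr1 x) = x ^ p + p * u) : L.delta x = S.red u := by
  rw [Lift.delta, h, add_sub_cancel_left, S.isRed.divP_mul]

theorem Lift.delta_add [Fact p.Prime] {S : FrobSetting p k A1' A0' A1 A0} (L : S.Lift) (x y : A1) :
    L.delta (x + y) = L.delta x + L.delta y - binom p (S.red x) (S.red y) := by
  obtain ⟨u, hu, hu'⟩ := L.F_pr1 x
  obtain ⟨v, hv, hv'⟩ := L.F_pr1 y
  have hb : S.red (binom p x y) = binom p (S.red x) (S.red y) := by
    simp [binom]
  rw [← hu, ← hv, ← hb, ← map_add, ← map_sub]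
  apply L.delta_eq
  rw [map_add, map_add, hu', hv', add_pow_binom]
  ring

theorem Lift.delta_mul {S : FrobSetting p k A1' A0' A1 A0} (L : S.Lift) (x y : A1) :
    L.delta (x * y) = S.red x ^ p * L.delta y + S.red y ^ p * L.delta x := by
  obtain ⟨u, hu, hu'⟩ := L.F_pr1 x
  obtain ⟨v, hv, hv'⟩ := L.F_pr1 y
  rw [← hu, ← hv, ← map_pow, ← map_pow, ← map_mul, ← map_mul, ← map_add]
  apply L.delta_eq
  rw [map_mul, map_mul, hu', hv']
  linear_combination (u * v) * S.isRed.p_sq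

theorem D_pow_p (S : FrobSetting p k A1' A0' A1 A0) (x : A0) : KaehlerDifferential.D k A0 (x ^ p) = 0 := by
  rw [Derivation.leibniz_pow, ← Nat.cast_smul_eq_nsmul A0, S.isRed.p_eq_zero, zero_smul]

theorem D_frob (x : A0') : KaehlerDifferential.D k A0 (S.frob x) = 0 := by
  obtain ⟨y, rfl⟩ := S.pr0.surjective x
  rw [S.frob_pr0, S.D_pow_p]

theorem D_delta_congr {x y : A1} (h : S.red x = S.red y) :
    KaehlerDifferential.D k A0 (L.delta x) = KaehlerDifferential.D k A0 (L.delta y) := by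
  obtain ⟨c, rfl⟩ := S.isRed.exists_of_red_eq h
  obtain ⟨v, hv, hv'⟩ := L.F_pr1 y
  have h1 : (p : A1) * L.F (S.pr1 c) = p * c ^ p :=
    S.isRed.mul_congr (by rw [L.red_F, S.red'_pr1, S.frob_pr0, map_pow])
  have : L.delta (y + p * c) = S.red (v + c ^ p) := by
    apply L.delta_eq
    rw [map_add, map_add, map_mul, map_mul, hv', map_natCast, map_natCast, h1,
      S.isRed.pow_p_congr h]
    ring
  rw [this, map_add, hv, map_add, map_pow, S.D_pow_p, add_zero]

/-- `x' ↦ x ^ (p - 1) dx + du` where `F(x') = x ^ p + p u`. -/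
noncomputable def dividedFun (a : A0') : Ω[A0⁄k] :=
  let x := Function.invFun S.red (S.pr0.symm a)
  S.red x ^ (p - 1) • KaehlerDifferential.D k A0 (S.red x) +
    KaehlerDifferential.D k A0 (L.delta x)

theorem dividedFun_pr0_red (x : A1) : dividedFun S L (S.pr0 (S.red x)) =
    S.red x ^ (p - 1) • KaehlerDifferential.D k A0 (S.red x) +
    KaehlerDifferential.D k A0 (L.delta x) := by
  have h : S.red (Function.invFun S.red (S.pr0.symm (S.pr0 (S.red x)))) = S.red x := by
    rw [RingEquiv.symm_apply_apply]
    exact Function.invFun_eq ⟨x, rfl⟩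
  simp only [dividedFun, S.D_delta_congr L h, h]

theorem exists_eq_pr0_red (a : A0') : ∃ x, S.pr0 (S.red x) = a := by
  obtain ⟨y, rfl⟩ := S.pr0.surjective a
  obtain ⟨x, rfl⟩ := S.isRed.surj y
  exact ⟨x, rfl⟩

theorem dividedFun_add [Fact p.Prime] (a b : A0') :
    dividedFun S L (a + b) = dividedFun S L a + dividedFun S L b := by
  obtain ⟨x, rfl⟩ := S.exists_eq_pr0_red a
  obtain ⟨y, rfl⟩ := S.exists_eq_pr0_red b
  rw [← map_add, ← map_add, dividedFun_pr0_red, dividedFun_pr0_red, dividedFun_pr0_red,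
    L.delta_add, map_sub, map_add, map_add, D_binom, map_add]
  module

theorem dividedFun_mul [hp : Fact p.Prime] (a b : A0') :
    dividedFun S L (a * b) = S.frob a • dividedFun S L b + S.frob b • dividedFun S L a := by
  obtain ⟨x, rfl⟩ := S.exists_eq_pr0_red a
  obtain ⟨y, rfl⟩ := S.exists_eq_pr0_red b
  obtain ⟨q, hq⟩ : ∃ q, p = q + 1 := ⟨p - 1, (Nat.succ_pred_prime hp.out).symm⟩
  rw [← map_mul, ← map_mul, dividedFun_pr0_red, dividedFun_pr0_red, dividedFun_pr0_red,
    L.delta_mul, map_mul, Derivation.leibniz, map_add, Derivation.leibniz, Derivation.leibniz,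
    S.D_pow_p, S.D_pow_p, S.frob_pr0, S.frob_pr0]
  have h1 : ∀ z : A0, z ^ p = z ^ (p - 1) * z := fun z => by rw [hq, pow_succ, Nat.add_sub_cancel]
  rw [h1, h1]
  module

/-- The divided Frobenius `F^* / p` on differential forms attached to a lift `F` of Frobenius: the
map, semilinear along the relative Frobenius, with `dx' ↦ x ^ (p - 1) dx + du` whenever
`F(x') = x ^ p + p u`. -/
noncomputable def Lift.divided {S : FrobSetting p k A1' A0' A1 A0} (L : S.Lift) [Fact p.Prime]
    [CharP k p] [PerfectRing k p] : Ω[A0'⁄k] →ₛₗ[S.frob] Ω[A0⁄k] :=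
  liftSemi S.frob (AddMonoidHom.mk' (dividedFun S L) (dividedFun_add S L)) (dividedFun_mul S L)
    (leibniz_const p S.isRed.p_eq_zero S.frob _ (dividedFun_mul S L))

theorem Lift.divided_D [Fact p.Prime] [CharP k p] [PerfectRing k p] (x : A1) :
    L.divided (KaehlerDifferential.D k A0' (S.pr0 (S.red x))) =
      S.red x ^ (p - 1) • KaehlerDifferential.D k A0 (S.red x) +
      KaehlerDifferential.D k A0 (L.delta x) := by
  exact (liftSemi_D ..).trans (dividedFun_pr0_red S L x)

/-- `x' ↦ (F(x̃) - G(x̃)) / p`, where `x̃` is any lift of `x'` modulo `p²`. -/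
noncomputable def homotopyFun (a : A0') : A0 :=
  let x := Function.invFun S.red' a
  divP p S.red (L.F x - M.F x)

theorem red_sub (x : A1') : S.red (L.F x - M.F x) = 0 := by
  rw [map_sub, L.red_F, M.red_F, sub_self]

theorem homotopyFun_red' (x : A1') :
    homotopyFun S L M (S.red' x) = divP p S.red (L.F x - M.F x) := by
  have h : S.red' (Function.invFun S.red' (S.red' x)) = S.red' x := Function.invFun_eq ⟨x, rfl⟩
  obtain ⟨c, hc⟩ := S.isRed'.exists_of_red_eq h
  have h1 : (p : A1) * L.F c = p * M.F c := S.isRed.mul_congr (by rw [L.red_F, M.red_F])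
  simp only [homotopyFun]
  congr 1
  rw [hc, map_add, map_add, map_mul, map_mul, map_natCast, map_natCast, h1]
  ring

theorem homotopyFun_add (a b : A0') :
    homotopyFun S L M (a + b) = homotopyFun S L M a + homotopyFun S L M b := by
  obtain ⟨x, rfl⟩ := S.isRed'.surj a
  obtain ⟨y, rfl⟩ := S.isRed'.surj b
  rw [← map_add, homotopyFun_red', homotopyFun_red', homotopyFun_red',
    ← S.isRed.divP_add (S.red_sub L M x) (S.red_sub L M y), map_add, map_add]
  congr 1
  ring

theorem homotopyFun_mul (a b : A0') :
    homotopyFun S L M (a * b) =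
      S.frob a • homotopyFun S L M b + S.frob b • homotopyFun S L M a := by
  obtain ⟨x, rfl⟩ := S.isRed'.surj a
  obtain ⟨y, rfl⟩ := S.isRed'.surj b
  rw [← map_mul, homotopyFun_red', homotopyFun_red', homotopyFun_red', smul_eq_mul, smul_eq_mul,
    ← L.red_F x, ← M.red_F y, ← S.isRed.divP_smul _ (S.red_sub L M x),
    ← S.isRed.divP_smul _ (S.red_sub L M y), ← S.isRed.divP_add, map_mul, map_mul]
  · congr 1
    ring
  · rw [map_mul, S.red_sub, mul_zero]
  · rw [map_mul, S.red_sub, mul_zero]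

/-- The homotopy `h` between two lifts `F`, `G` of Frobenius: the map from differential forms to
functions, semilinear along the relative Frobenius, with `dx' ↦ (F(x̃) - G(x̃)) / p` for any lift
`x̃` of `x'` modulo `p²`. -/
noncomputable def homotopy [Fact p.Prime] [CharP k p] [PerfectRing k p] :
    Ω[A0'⁄k] →ₛₗ[S.frob] A0 :=
  liftSemi S.frob (AddMonoidHom.mk' (homotopyFun S L M) (homotopyFun_add S L M))
    (homotopyFun_mul S L M)
    (leibniz_const p S.isRed.p_eq_zero S.frob _ (homotopyFun_mul S L M))

theorem homotopy_D [Fact p.Prime] [CharP k p] [PerfectRing k p] (x : A1') :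
    S.homotopy L M (KaehlerDifferential.D k A0' (S.red' x)) = divP p S.red (L.F x - M.F x) := by
  exact (liftSemi_D ..).trans (homotopyFun_red' S L M x)

theorem D_homotopy [Fact p.Prime] [CharP k p] [PerfectRing k p] (w : Ω[A0'⁄k]) :
    KaehlerDifferential.D k A0 (S.homotopy L M w) = L.divided w - M.divided w := by
  refine addHom_ext S.frob
    ((KaehlerDifferential.D k A0).toLinearMap.toAddMonoidHom.comp (S.homotopy L M).toAddMonoidHom)
    (L.divided.toAddMonoidHom - M.divided.toAddMonoidHom) ?_ ?_ ?_ w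
  · intro a w
    change KaehlerDifferential.D k A0 (S.homotopy L M (a • w)) =
      S.frob a • KaehlerDifferential.D k A0 (S.homotopy L M w)
    rw [LinearMap.map_smulₛₗ, smul_eq_mul, Derivation.leibniz, S.D_frob, smul_zero, add_zero]
  · intro a w
    change L.divided (a • w) - M.divided (a • w) = S.frob a • (L.divided w - M.divided w)
    rw [LinearMap.map_smulₛₗ, LinearMap.map_smulₛₗ, smul_sub]
  · intro a
    change KaehlerDifferential.D k A0 (S.homotopy L M (KaehlerDifferential.D k A0' a)) =
      L.divided (KaehlerDifferential.D k A0' a) - M.divided (KaehlerDifferential.D k A0' a)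
    obtain ⟨x, rfl⟩ := S.exists_eq_pr0_red a
    rw [L.divided_D, M.divided_D, ← S.red'_pr1, homotopy_D]
    obtain ⟨u, hu, hu'⟩ := L.F_pr1 x
    obtain ⟨v, hv, hv'⟩ := M.F_pr1 x
    have : L.F (S.pr1 x) - M.F (S.pr1 x) = p * (u - v) := by rw [hu', hv']; ring
    rw [this, S.isRed.divP_mul, map_sub, map_sub, hu, hv]
    abel

variable {B1' B0' B1 B0 : Type*} [CommRing B1'] [CommRing B0']
    [CommRing B1] [CommRing B0] [Algebra k B0'] [Algebra k B0]

/-- Restriction of functions to a smaller open, on the curve, its twist, and their lifts. -/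
structure Restr (S : FrobSetting p k A1' A0' A1 A0) (T : FrobSetting p k B1' B0' B1 B0) where
  j1' : A1' →+* B1'
  j0' : A0' →ₐ[k] B0'
  j1 : A1 →+* B1
  j0 : A0 →ₐ[k] B0
  red_j1 : ∀ x, T.red (j1 x) = j0 (S.red x)
  red'_j1' : ∀ x, T.red' (j1' x) = j0' (S.red' x)
  pr1_j1 : ∀ x, T.pr1 (j1 x) = j1' (S.pr1 x)

namespace Restr

variable {S} {T : FrobSetting p k B1' B0' B1 B0} (j : S.Restr T)

theorem pr0_j0 (x : A0) : T.pr0 (j.j0 x) = j.j0' (S.pr0 x) := by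
  obtain ⟨x, rfl⟩ := S.isRed.surj x
  rw [← j.red_j1, ← T.red'_pr1, j.pr1_j1, j.red'_j1', S.red'_pr1]

theorem frob_j0' (x : A0') : T.frob (j.j0' x) = j.j0 (S.frob x) := by
  obtain ⟨x, rfl⟩ := S.pr0.surjective x
  rw [← j.pr0_j0, T.frob_pr0, S.frob_pr0, map_pow]

theorem divided_res [Fact p.Prime] [CharP k p] [PerfectRing k p] {L : S.Lift} {M : T.Lift}
    (hLM : ∀ x, M.F (j.j1' x) = j.j1 (L.F x)) (w : Ω[A0'⁄k]) :
    resOmega j.j0 (L.divided w) = M.divided (resOmega j.j0' w) := by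
  refine addHom_ext ((j.j0 : A0 →+* B0).comp S.frob)
    ((resOmega j.j0).toAddMonoidHom.comp L.divided.toAddMonoidHom)
    (M.divided.toAddMonoidHom.comp (resOmega j.j0').toAddMonoidHom) ?_ ?_ ?_ w
  · intro a w
    change resOmega j.j0 (L.divided (a • w)) = j.j0 (S.frob a) • resOmega j.j0 (L.divided w)
    rw [LinearMap.map_smulₛₗ, resOmega_smul]
  · intro a w
    change M.divided (resOmega j.j0' (a • w)) = j.j0 (S.frob a) • M.divided (resOmega j.j0' w)
    rw [resOmega_smul, LinearMap.map_smulₛₗ, frob_j0']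
  · intro a
    change resOmega j.j0 (L.divided (KaehlerDifferential.D k A0' a)) =
      M.divided (resOmega j.j0' (KaehlerDifferential.D k A0' a))
    obtain ⟨x, rfl⟩ := S.exists_eq_pr0_red a
    obtain ⟨u, hu, hu'⟩ := L.F_pr1 x
    have h : M.delta (j.j1 x) = T.red (j.j1 u) := by
      apply M.delta_eq
      rw [j.pr1_j1, hLM, hu', map_add, map_pow, map_mul, map_natCast]
    rw [L.divided_D, resOmega_D, ← j.pr0_j0, ← j.red_j1, M.divided_D, map_add, resOmega_smul,
      resOmega_D, resOmega_D, h, j.red_j1, j.red_j1, hu, map_pow]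

end Restr

end FrobSetting

/-! ### The divided Frobenius of a curve covered by two affine opens -/

namespace FrobSetting

section Linear

variable {p : ℕ} {k A1' A0' A1 A0 : Type*} [Field k] [CommRing A1'] [CommRing A0']
    [CommRing A1] [CommRing A0] [Algebra k A0'] [Algebra k A0]
    (S : FrobSetting p k A1' A0' A1 A0) [Fact p.Prime] [CharP k p]

/-- The relative Frobenius, as a `k`-linear map. -/
noncomputable def frobLin : A0' →ₗ[k] A0 where
  toFun := S.frob
  map_add' := map_add _
  map_smul' c x := by
    rw [Algebra.smul_def, map_mul, S.frob_const, Algebra.smul_def, RingHom.id_apply]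

/-- The divided Frobenius on differential forms, as a `k`-linear map. -/
noncomputable def Lift.dividedLin {S : FrobSetting p k A1' A0' A1 A0} (L : S.Lift)
    [PerfectRing k p] : Ω[A0'⁄k] →ₗ[k] Ω[A0⁄k] where
  toFun := L.divided
  map_add' := map_add _
  map_smul' c w := by
    rw [← algebraMap_smul A0' c w, LinearMap.map_smulₛₗ, S.frob_const, algebraMap_smul,
      RingHom.id_apply]

/-- The homotopy between two lifts of Frobenius, as a `k`-linear map. -/
noncomputable def homotopyLin (L M : S.Lift) [PerfectRing k p] : Ω[A0'⁄k] →ₗ[k] A0 where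
  toFun := S.homotopy L M
  map_add' := map_add _
  map_smul' c w := by
    rw [← algebraMap_smul A0' c w, LinearMap.map_smulₛₗ, S.frob_const, algebraMap_smul,
      RingHom.id_apply]

/-- The projection from the twist, on functions, as a semilinear map. -/
noncomputable def prLin : A0 →ₛₗ[frobenius k p] A0' where
  toFun := S.pr0
  map_add' := map_add _
  map_smul' c x := by
    rw [Algebra.smul_def, map_mul, S.pr0_const, Algebra.smul_def]
    rfl

/-- The projection from the twist, on differential forms `a dx ↦ pr(a) d(pr x)`. -/
noncomputable def prOmega : Ω[A0⁄k] →ₛₗ[frobenius k p] Ω[A0'⁄k] where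
  toFun := omegaMap (S.pr0 : A0 →+* A0') (fun c => ⟨c ^ p, S.pr0_const c⟩)
  map_add' := map_add _
  map_smul' c w := by
    rw [← algebraMap_smul A0 c w, LinearMap.map_smulₛₗ]
    change S.pr0 (algebraMap k A0 c) • _ = _
    rw [S.pr0_const, algebraMap_smul]
    rfl

theorem prOmega_smul (a : A0) (w : Ω[A0⁄k]) : S.prOmega (a • w) = S.pr0 a • S.prOmega w :=
  (omegaMap (S.pr0 : A0 →+* A0') (fun c => ⟨c ^ p, S.pr0_const c⟩)).map_smulₛₗ a w

theorem prOmega_D (x : A0) : S.prOmega (KaehlerDifferential.D k A0 x) =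
    KaehlerDifferential.D k A0' (S.pr0 x) := by
  change omegaMap (S.pr0 : A0 →+* A0') _ _ = _
  rw [omegaMap_D]
  rfl

end Linear

section TwoCharts

variable {p : ℕ} {k U1' U0' U1 U0 V1' V0' V1 V0 B1' B0' B1 B0 : Type*} [Field k]
  [CommRing U1'] [CommRing U0'] [CommRing U1] [CommRing U0] [Algebra k U0'] [Algebra k U0]
  [CommRing V1'] [CommRing V0'] [CommRing V1] [CommRing V0] [Algebra k V0'] [Algebra k V0]
  [CommRing B1'] [CommRing B0'] [CommRing B1] [CommRing B0] [Algebra k B0'] [Algebra k B0]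
  {SU : FrobSetting p k U1' U0' U1 U0} {SV : FrobSetting p k V1' V0' V1 V0}
  {T : FrobSetting p k B1' B0' B1 B0}

/-- A lift of Frobenius on an open, together with its extension to a smaller open. -/
structure Restr.Lift {S : FrobSetting p k U1' U0' U1 U0} (j : S.Restr T) where
  big : S.Lift
  small : T.Lift
  compat : ∀ x, small.F (j.j1' x) = j.j1 (big.F x)

variable [Fact p.Prime] [CharP k p] (jU : SU.Restr T) (jV : SV.Restr T)

theorem prOmega_res {S : FrobSetting p k U1' U0' U1 U0} (j : S.Restr T) (w : Ω[U0⁄k]) :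
    resOmega j.j0' (S.prOmega w) = T.prOmega (resOmega j.j0 w) := by
  refine addHom_ext ((j.j0' : U0' →+* B0').comp (S.pr0 : U0 →+* U0'))
    ((resOmega j.j0').toAddMonoidHom.comp S.prOmega.toAddMonoidHom)
    (T.prOmega.toAddMonoidHom.comp (resOmega j.j0).toAddMonoidHom) ?_ ?_ ?_ w
  · intro a w
    change resOmega j.j0' (S.prOmega (a • w)) = j.j0' (S.pr0 a) • resOmega j.j0' (S.prOmega w)
    rw [prOmega_smul, resOmega_smul]
  · intro a w
    change T.prOmega (resOmega j.j0 (a • w)) = j.j0' (S.pr0 a) • T.prOmega (resOmega j.j0 w)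
    rw [resOmega_smul, prOmega_smul, j.pr0_j0]
  · intro a
    change resOmega j.j0' (S.prOmega (KaehlerDifferential.D k U0 a)) =
      T.prOmega (resOmega j.j0 (KaehlerDifferential.D k U0 a))
    rw [prOmega_D, resOmega_D, resOmega_D, prOmega_D, j.pr0_j0]

/-- The isomorphism `pr : H⁰(X, Ω¹) → H⁰(X', Ω¹)`, semilinear along the Frobenius of `k`. -/
noncomputable def prH0 : H0Omega jU.j0 jV.j0 →ₛₗ[frobenius k p] H0Omega jU.j0' jV.j0' where
  toFun w := ⟨(SU.prOmega w.1.1, SV.prOmega w.1.2), by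
    have := (mem_H0Omega _ _).1 w.2
    rw [mem_H0Omega, prOmega_res, prOmega_res, this]⟩
  map_add' w w' := by ext <;> simp
  map_smul' c w := by
    apply Subtype.ext
    change (SU.prOmega (c • w.1.1), SV.prOmega (c • w.1.2)) = _
    rw [LinearMap.map_smulₛₗ, LinearMap.map_smulₛₗ]
    rfl

/-- The isomorphism `pr : H¹(X, O) → H¹(X', O)`, semilinear along the Frobenius of `k`. -/
noncomputable def prH1 : H1O jU.j0 jV.j0 →ₛₗ[frobenius k p] H1O jU.j0' jV.j0' :=
  Submodule.mapQ _ _ T.prLin (by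
    rintro _ ⟨⟨a, b⟩, rfl⟩
    refine ⟨(SU.pr0 a, SV.pr0 b), ?_⟩
    change jU.j0' (SU.pr0 a) - jV.j0' (SV.pr0 b) = T.pr0 (jU.j0 a - jV.j0 b)
    rw [map_sub, jU.pr0_j0, jV.pr0_j0])

variable [PerfectRing k p] {jU jV} (LU : jU.Lift) (LV : jV.Lift)

/-- The third component of the degree-one part of the Deligne-Illusie morphism: the map `h` from
differential forms on the intersection of the two opens of the twist to functions on the
intersection, with `h(dx') = (F_U(x̃) - F_V(x̃)) / p`. -/
noncomputable def hDI : Ω[B0'⁄k] →ₗ[k] B0 := T.homotopyLin LU.small LV.small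

/-- The degree-one part of the Deligne-Illusie morphism, on cocycles:
`ω ↦ (f_U(ω|U), f_V(ω|V), h(ω|U∩V))`. -/
noncomputable def cocycleDI1 : H0Omega jU.j0' jV.j0' →ₗ[k] dRZ1 jU.j0 jV.j0 :=
  LinearMap.codRestrict _
    ((((LU.big.dividedLin.comp (LinearMap.fst k _ _)).prod
      (LV.big.dividedLin.comp (LinearMap.snd k _ _))).prod
      ((hDI LU LV).comp ((resOmega jU.j0').comp (LinearMap.fst k _ _)))).comp
        (H0Omega jU.j0' jV.j0').subtype) (by
    intro w
    have h := (mem_H0Omega _ _).1 w.2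
    rw [mem_dRZ1]
    change resOmega jV.j0 (LV.big.divided w.1.2) - resOmega jU.j0 (LU.big.divided w.1.1) +
      KaehlerDifferential.D k B0 (T.homotopy LU.small LV.small (resOmega jU.j0' w.1.1)) = 0
    rw [Restr.divided_res jV LV.compat, Restr.divided_res jU LU.compat, D_homotopy, ← h]
    abel)

/-- `H⁰(X', Ω¹) → H¹_DR(X)` induced by the Deligne-Illusie morphism. -/
noncomputable def DI1 : H0Omega jU.j0' jV.j0' →ₗ[k] H1dR jU.j0 jV.j0 :=
  (classDR _ _).comp (cocycleDI1 LU LV)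

variable (jU jV) in
/-- `H¹(X', O) → H¹_DR(X)` induced by the Deligne-Illusie morphism, `[h] ↦ [(0, 0, F(h))]` with `F`
the relative Frobenius. -/
noncomputable def DI0 : H1O jU.j0' jV.j0' →ₗ[k] H1dR jU.j0 jV.j0 :=
  Submodule.liftQ _ ((classDR _ _).comp (LinearMap.codRestrict (dRZ1 jU.j0 jV.j0)
    ((LinearMap.inr k _ _).comp T.frobLin) (fun x => by
      rw [mem_dRZ1]
      change resOmega jV.j0 0 - resOmega jU.j0 0 + KaehlerDifferential.D k B0 (T.frob x) = 0
      rw [T.D_frob, map_zero, map_zero, sub_zero, add_zero]))) (by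
    rintro _ ⟨⟨a, b⟩, rfl⟩
    rw [LinearMap.mem_ker, LinearMap.comp_apply, Submodule.mkQ_apply,
      Submodule.Quotient.mk_eq_zero, Submodule.mem_comap]
    refine ⟨(SU.frob a, SV.frob b), ?_⟩
    change ((KaehlerDifferential.D k U0 (SU.frob a), KaehlerDifferential.D k V0 (SV.frob b)),
      jU.j0 (SU.frob a) - jV.j0 (SV.frob b)) = (0, T.frob (jU.j0' a - jV.j0' b))
    rw [SU.D_frob, SV.D_frob, map_sub, jU.frob_j0', jV.frob_j0']
    rfl)

/-- The divided Frobenius `Φ' : H⁰(X', Ω¹) ⊕ H¹(X', O) → H¹_DR(X)` given by the Deligne-Illusie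
morphism. -/
noncomputable def Phi' :
    H0Omega jU.j0' jV.j0' × H1O jU.j0' jV.j0' →ₗ[k] H1dR jU.j0 jV.j0 :=
  (DI1 LU LV).coprod (DI0 jU jV)

/-- The divided Frobenius `Φ = Φ' ∘ pr : H⁰(X, Ω¹) ⊕ H¹(X, O) → H¹_DR(X)`. -/
noncomputable def Phi :
    H0Omega jU.j0 jV.j0 × H1O jU.j0 jV.j0 →ₛₗ[frobenius k p] H1dR jU.j0 jV.j0 where
  toFun x := Phi' LU LV (prH0 jU jV x.1, prH1 jU jV x.2)
  map_add' x y := by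
    rw [← map_add, Prod.fst_add, Prod.snd_add, map_add, map_add]
    rfl
  map_smul' c x := by
    rw [Prod.smul_fst, Prod.smul_snd, LinearMap.map_smulₛₗ, LinearMap.map_smulₛₗ, ← Prod.smul_mk,
      map_smul]

end TwoCharts

end FrobSetting

/-! ### The ring `W₁ = W(k) / p²` -/

section Base

variable (p : ℕ) [hp : Fact p.Prime] (k : Type*) [Field k] [CharP k p]

/-- The ring `W₁ = W(k) / p²`. -/
abbrev W1 : Type _ := WittVector p k ⧸ Ideal.span {(p : WittVector p k) ^ 2}

/-- The reduction modulo `p`, `W₁ → k`. -/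
noncomputable def redW : W1 p k →+* k :=
  Ideal.Quotient.lift _ WittVector.constantCoeff (fun a ha => by
    obtain ⟨b, rfl⟩ := Ideal.mem_span_singleton'.1 ha
    rw [map_mul, map_pow, map_natCast, CharP.cast_eq_zero, zero_pow two_ne_zero, mul_zero])

/-- The Frobenius `σ` of `W₁`. -/
noncomputable def sigmaW : W1 p k →+* W1 p k :=
  Ideal.Quotient.lift _ ((Ideal.Quotient.mk _).comp WittVector.frobenius) (fun a ha => by
    obtain ⟨b, rfl⟩ := Ideal.mem_span_singleton'.1 ha
    rw [RingHom.comp_apply, Ideal.Quotient.eq_zero_iff_mem, map_mul, map_pow, map_natCast]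
    exact Ideal.mul_mem_left _ _ (Ideal.mem_span_singleton_self _))

theorem redW_sigmaW (c : W1 p k) : redW p k (sigmaW p k c) = redW p k c ^ p := by
  obtain ⟨a, rfl⟩ := Ideal.Quotient.mk_surjective c
  change WittVector.constantCoeff (WittVector.frobenius a) = WittVector.constantCoeff a ^ p
  simp [WittVector.constantCoeff_apply, WittVector.coeff_frobenius_charP]

theorem isReduction_redW [PerfectRing k p] : IsReduction p (redW p k) where
  surj b := by
    obtain ⟨a, ha⟩ := WittVector.constantCoeff_surjective p b
    exact ⟨Ideal.Quotient.mk _ a, ha⟩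
  ker c := by
    obtain ⟨a, rfl⟩ := Ideal.Quotient.mk_surjective c
    change WittVector.constantCoeff a = 0 ↔ _
    rw [← RingHom.mem_ker, WittVector.ker_constantCoeff, Ideal.mem_span_singleton']
    constructor
    · rintro ⟨b, rfl⟩
      exact ⟨Ideal.Quotient.mk _ b, by rw [map_mul, map_natCast, mul_comm]⟩
    · rintro ⟨b, hb⟩
      obtain ⟨b, rfl⟩ := Ideal.Quotient.mk_surjective b
      rw [← map_natCast (Ideal.Quotient.mk _), ← map_mul, Ideal.Quotient.eq,
        Ideal.mem_span_singleton'] at hb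
      obtain ⟨d, hd⟩ := hb
      exact ⟨b + d * p, by linear_combination hd⟩
  tors c := by
    obtain ⟨a, rfl⟩ := Ideal.Quotient.mk_surjective c
    change WittVector.constantCoeff a = 0 ↔ _
    rw [← RingHom.mem_ker, WittVector.ker_constantCoeff, Ideal.mem_span_singleton',
      ← map_natCast (Ideal.Quotient.mk _), ← map_mul, Ideal.Quotient.eq_zero_iff_mem,
      Ideal.mem_span_singleton']
    constructor
    · rintro ⟨b, rfl⟩
      exact ⟨b, by ring⟩
    · rintro ⟨b, hb⟩
      refine ⟨b, ?_⟩
      rw [← sub_eq_zero]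
      apply WittVector.eq_zero_of_p_mul_eq_zero
      linear_combination hb

end Base

/-! ### Coordinate rings of superelliptic curves -/

section Charts

/-- The ring `R[x, y] / (y ^ n - g(x))`. -/
def Chart (R : Type*) [CommRing R] (n : ℕ) (g : R[X]) : Type _ :=
  AdjoinRoot (X ^ n - C g : R[X][X])

namespace Chart

variable {R : Type*} [CommRing R] {n : ℕ} {g : R[X]} {S : Type*} [CommRing S]

noncomputable instance : CommRing (Chart R n g) :=
  inferInstanceAs (CommRing (AdjoinRoot (X ^ n - C g : R[X][X])))

noncomputable instance : Algebra R (Chart R n g) :=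
  inferInstanceAs (Algebra R (AdjoinRoot (X ^ n - C g : R[X][X])))

variable (R n g) in
/-- The coordinate function `x`. -/
noncomputable def x : Chart R n g := AdjoinRoot.of (X ^ n - C g : R[X][X]) X

variable (R n g) in
/-- The coordinate function `y`. -/
noncomputable def y : Chart R n g := AdjoinRoot.root (X ^ n - C g : R[X][X])

theorem algebraMap_eq (c : R) :
    algebraMap R (Chart R n g) c = AdjoinRoot.of (X ^ n - C g : R[X][X]) (C c) := rfl

theorem of_eq (f : R[X]) :
    AdjoinRoot.of (X ^ n - C g : R[X][X]) f = f.eval₂ (algebraMap R (Chart R n g)) (x R n g) := by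
  have : (AdjoinRoot.of (X ^ n - C g : R[X][X])) =
      (eval₂RingHom (algebraMap R (Chart R n g)) (x R n g) : R[X] →+* Chart R n g) := by
    ext c
    · exact (eval₂_C _ _).symm
    · exact (eval₂_X _ _).symm
  exact congrArg (fun φ : R[X] →+* Chart R n g => φ f) this

theorem y_pow : y R n g ^ n = g.eval₂ (algebraMap R (Chart R n g)) (x R n g) := by
  have := AdjoinRoot.eval₂_root (X ^ n - C g : R[X][X])
  simp only [eval₂_sub, eval₂_pow, eval₂_X, eval₂_C, sub_eq_zero] at this
  rw [← of_eq]
  exact this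

/-- The ring morphism from `Chart R n g` extending `φ` with `x ↦ a`, `y ↦ b`. -/
noncomputable def lift (φ : R →+* S) (a b : S) (h : b ^ n = g.eval₂ φ a) : Chart R n g →+* S :=
  AdjoinRoot.lift (eval₂RingHom φ a) b (by simp [h])

theorem lift_const (φ : R →+* S) (a b : S) (h : b ^ n = g.eval₂ φ a) (c : R) :
    lift φ a b h (algebraMap R _ c) = φ c := by
  rw [algebraMap_eq]
  exact (AdjoinRoot.lift_of _).trans (by simp)

theorem lift_x (φ : R →+* S) (a b : S) (h : b ^ n = g.eval₂ φ a) : lift φ a b h (x R n g) = a :=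
  (AdjoinRoot.lift_of _).trans (by simp)

theorem lift_y (φ : R →+* S) (a b : S) (h : b ^ n = g.eval₂ φ a) : lift φ a b h (y R n g) = b :=
  AdjoinRoot.lift_root _

theorem hom_ext {φ ψ : Chart R n g →+* S}
    (hc : ∀ c : R, φ (algebraMap R _ c) = ψ (algebraMap R _ c))
    (hx : φ (x R n g) = ψ (x R n g)) (hy : φ (y R n g) = ψ (y R n g)) : φ = ψ := by
  refine AdjoinRoot.ringHom_ext ?_ hy
  ext c
  · exact hc c
  · exact hx

theorem hom_y_pow (φ : Chart R n g →+* S) :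
    φ (y R n g) ^ n = g.eval₂ (φ.comp (algebraMap R _)) (φ (x R n g)) := by
  rw [← map_pow, y_pow, hom_eval₂]

theorem isReduction {p : ℕ} {τ : R →+* S} (H : IsReduction p τ) (hn : n ≠ 0) {g' : S[X]}
    (φ : Chart R n g →+* Chart S n g')
    (hc : ∀ c : R, φ (algebraMap R _ c) = algebraMap S _ (τ c))
    (hx : φ (x R n g) = x S n g') (hy : φ (y R n g) = y S n g') (hg : g.map τ = g') :
    IsReduction p φ := by
  refine IsReduction.adjoinRoot H.polynomial (X ^ n - C g) (monic_X_pow_sub_C g hn)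
    (X ^ n - C g') (by simp [hg]) φ ?_
  intro f
  have h1 : φ.comp (AdjoinRoot.mk (X ^ n - C g : R[X][X])) =
      (AdjoinRoot.mk (X ^ n - C g' : S[X][X])).comp (mapRingHom (mapRingHom τ)) := by
    ext c
    · change φ (algebraMap R (Chart R n g) c) =
        AdjoinRoot.mk (X ^ n - C g' : S[X][X]) (mapRingHom (mapRingHom τ) (C (C c)))
      rw [hc]
      simp only [coe_mapRingHom, map_C]
      rfl
    · change φ (x R n g) =
        AdjoinRoot.mk (X ^ n - C g' : S[X][X]) (mapRingHom (mapRingHom τ) (C X))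
      rw [hx]
      simp only [coe_mapRingHom, map_C, map_X]
      rfl
    · change φ (y R n g) =
        AdjoinRoot.mk (X ^ n - C g' : S[X][X]) (mapRingHom (mapRingHom τ) X)
      rw [hy]
      simp only [coe_mapRingHom, map_X]
      rfl
  exact congrArg (fun ψ => ψ f) h1

end Chart

/-- The ring `R[x, y, y⁻¹] / (y ^ n - g(x))`. -/
def ChartY (R : Type*) [CommRing R] (n : ℕ) (g : R[X]) : Type _ :=
  Localization.Away (Chart.y R n g)

/-- The ring `R[x, x⁻¹, y, y⁻¹] / (y ^ n - g(x))`. -/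
def ChartXY (R : Type*) [CommRing R] (n : ℕ) (g : R[X]) : Type _ :=
  Localization.Away (Chart.x R n g * Chart.y R n g)

section Loc

variable {R : Type*} [CommRing R] {n : ℕ} {g : R[X]} {S : Type*} [CommRing S]

noncomputable instance : CommRing (ChartY R n g) :=
  inferInstanceAs (CommRing (Localization.Away (Chart.y R n g)))
noncomputable instance : Algebra (Chart R n g) (ChartY R n g) :=
  inferInstanceAs (Algebra (Chart R n g) (Localization.Away (Chart.y R n g)))
noncomputable instance : Algebra R (ChartY R n g) :=
  inferInstanceAs (Algebra R (Localization.Away (Chart.y R n g)))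
instance : IsScalarTower R (Chart R n g) (ChartY R n g) :=
  inferInstanceAs (IsScalarTower R (Chart R n g) (Localization.Away (Chart.y R n g)))
instance : IsLocalization.Away (Chart.y R n g) (ChartY R n g) :=
  inferInstanceAs (IsLocalization.Away (Chart.y R n g) (Localization.Away (Chart.y R n g)))

noncomputable instance : CommRing (ChartXY R n g) :=
  inferInstanceAs (CommRing (Localization.Away (Chart.x R n g * Chart.y R n g)))
noncomputable instance : Algebra (Chart R n g) (ChartXY R n g) :=
  inferInstanceAs (Algebra (Chart R n g) (Localization.Away (Chart.x R n g * Chart.y R n g)))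
noncomputable instance : Algebra R (ChartXY R n g) :=
  inferInstanceAs (Algebra R (Localization.Away (Chart.x R n g * Chart.y R n g)))
instance : IsScalarTower R (Chart R n g) (ChartXY R n g) :=
  inferInstanceAs (IsScalarTower R (Chart R n g)
    (Localization.Away (Chart.x R n g * Chart.y R n g)))
instance : IsLocalization.Away (Chart.x R n g * Chart.y R n g) (ChartXY R n g) :=
  inferInstanceAs (IsLocalization.Away (Chart.x R n g * Chart.y R n g)
    (Localization.Away (Chart.x R n g * Chart.y R n g)))

namespace ChartY

variable (R n g) in
/-- The coordinate function `x`. -/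
noncomputable def x : ChartY R n g := algebraMap (Chart R n g) _ (Chart.x R n g)

variable (R n g) in
/-- The invertible coordinate function `y`. -/
noncomputable def y : (ChartY R n g)ˣ :=
  (IsLocalization.Away.algebraMap_isUnit (S := ChartY R n g) (Chart.y R n g)).unit

theorem y_val : (y R n g : ChartY R n g) = algebraMap (Chart R n g) _ (Chart.y R n g) := rfl

/-- The ring morphism from `ChartY R n g` extending `φ` with `x ↦ a`, `y ↦ b`. -/
noncomputable def lift (φ : R →+* S) (a : S) (b : Sˣ) (h : (b : S) ^ n = g.eval₂ φ a) :
    ChartY R n g →+* S :=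
  IsLocalization.Away.lift (Chart.y R n g) (g := Chart.lift φ a b h)
    (by rw [Chart.lift_y]; exact b.isUnit)

theorem lift_const (φ : R →+* S) (a : S) (b : Sˣ) (h : (b : S) ^ n = g.eval₂ φ a) (c : R) :
    lift φ a b h (algebraMap R _ c) = φ c := by
  rw [IsScalarTower.algebraMap_apply R (Chart R n g), lift, IsLocalization.Away.lift_eq,
    Chart.lift_const]

theorem lift_x (φ : R →+* S) (a : S) (b : Sˣ) (h : (b : S) ^ n = g.eval₂ φ a) :
    lift φ a b h (x R n g) = a := by
  rw [x, lift, IsLocalization.Away.lift_eq, Chart.lift_x]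

theorem lift_y (φ : R →+* S) (a : S) (b : Sˣ) (h : (b : S) ^ n = g.eval₂ φ a) :
    lift φ a b h (y R n g) = b := by
  rw [y_val, lift, IsLocalization.Away.lift_eq, Chart.lift_y]

theorem hom_ext {φ ψ : ChartY R n g →+* S}
    (hc : ∀ c : R, φ (algebraMap R _ c) = ψ (algebraMap R _ c))
    (hx : φ (x R n g) = ψ (x R n g)) (hy : φ (y R n g) = ψ (y R n g)) : φ = ψ := by
  refine IsLocalization.ringHom_ext (Submonoid.powers (Chart.y R n g)) (Chart.hom_ext ?_ hx hy)
  intro c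
  simpa [← IsScalarTower.algebraMap_apply] using hc c

theorem y_pow : (y R n g : ChartY R n g) ^ n =
    g.eval₂ (algebraMap R (ChartY R n g)) (x R n g) := by
  rw [y_val, x, Chart.hom_y_pow, ← IsScalarTower.algebraMap_eq]

theorem isReduction {p : ℕ} {τ : R →+* S} (H : IsReduction p τ) (hn : n ≠ 0) {g' : S[X]}
    (φ : ChartY R n g →+* ChartY S n g')
    (hc : ∀ c : R, φ (algebraMap R _ c) = algebraMap S _ (τ c))
    (hx : φ (x R n g) = x S n g') (hy : φ (y R n g) = y S n g') (hg : g.map τ = g') :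
    IsReduction p φ := by
  have h0 : (Chart.y S n g') ^ n =
      g.eval₂ ((algebraMap S (Chart S n g')).comp τ) (Chart.x S n g') := by
    rw [Chart.y_pow, ← hg, eval₂_map]
  refine (Chart.isReduction H hn (Chart.lift _ _ _ h0) (fun c => Chart.lift_const ..)
    (Chart.lift_x ..) (Chart.lift_y ..) hg).localization (Chart.y R n g) (Chart.y S n g')
    (Chart.lift_y ..) φ ?_
  have : φ.comp (algebraMap (Chart R n g) _) =
      (algebraMap (Chart S n g') _).comp (Chart.lift _ _ _ h0) := by
    refine Chart.hom_ext (fun c => ?_) ?_ ?_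
    · simp only [RingHom.comp_apply, Chart.lift_const]
      rw [← IsScalarTower.algebraMap_apply, ← IsScalarTower.algebraMap_apply, hc]
    · simp only [RingHom.comp_apply, Chart.lift_x]
      exact hx
    · simp only [RingHom.comp_apply, Chart.lift_y]
      exact hy
  intro a
  exact congrArg (fun ψ => ψ a) this

end ChartY

namespace ChartXY

theorem isUnit_xy : IsUnit (algebraMap (Chart R n g) (ChartXY R n g) (Chart.x R n g) *
    algebraMap (Chart R n g) (ChartXY R n g) (Chart.y R n g)) := by
  rw [← map_mul]
  exact IsLocalization.Away.algebraMap_isUnit _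

variable (R n g) in
/-- The invertible coordinate function `x`. -/
noncomputable def x : (ChartXY R n g)ˣ := (isUnit_of_mul_isUnit_left (isUnit_xy (g := g))).unit

variable (R n g) in
/-- The invertible coordinate function `y`. -/
noncomputable def y : (ChartXY R n g)ˣ := (isUnit_of_mul_isUnit_right (isUnit_xy (g := g))).unit

theorem x_val : (x R n g : ChartXY R n g) = algebraMap (Chart R n g) _ (Chart.x R n g) := rfl

theorem y_val : (y R n g : ChartXY R n g) = algebraMap (Chart R n g) _ (Chart.y R n g) := rfl

/-- The ring morphism from `ChartXY R n g` extending `φ` with `x ↦ a`, `y ↦ b`. -/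
noncomputable def lift (φ : R →+* S) (a b : Sˣ) (h : (b : S) ^ n = g.eval₂ φ (a : S)) :
    ChartXY R n g →+* S :=
  IsLocalization.Away.lift (Chart.x R n g * Chart.y R n g) (g := Chart.lift φ a b h)
    (by rw [map_mul, Chart.lift_x, Chart.lift_y]; exact a.isUnit.mul b.isUnit)

theorem lift_const (φ : R →+* S) (a b : Sˣ) (h : (b : S) ^ n = g.eval₂ φ (a : S)) (c : R) :
    lift φ a b h (algebraMap R _ c) = φ c := by
  rw [IsScalarTower.algebraMap_apply R (Chart R n g), lift, IsLocalization.Away.lift_eq,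
    Chart.lift_const]

theorem lift_x (φ : R →+* S) (a b : Sˣ) (h : (b : S) ^ n = g.eval₂ φ (a : S)) :
    lift φ a b h (x R n g) = a := by
  rw [x_val, lift, IsLocalization.Away.lift_eq, Chart.lift_x]

theorem lift_y (φ : R →+* S) (a b : Sˣ) (h : (b : S) ^ n = g.eval₂ φ (a : S)) :
    lift φ a b h (y R n g) = b := by
  rw [y_val, lift, IsLocalization.Away.lift_eq, Chart.lift_y]

theorem hom_ext {φ ψ : ChartXY R n g →+* S}
    (hc : ∀ c : R, φ (algebraMap R _ c) = ψ (algebraMap R _ c))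
    (hx : φ (x R n g) = ψ (x R n g)) (hy : φ (y R n g) = ψ (y R n g)) : φ = ψ := by
  refine IsLocalization.ringHom_ext (Submonoid.powers (Chart.x R n g * Chart.y R n g))
    (Chart.hom_ext ?_ hx hy)
  intro c
  simpa [← IsScalarTower.algebraMap_apply] using hc c

theorem y_pow : (y R n g : ChartXY R n g) ^ n =
    g.eval₂ (algebraMap R (ChartXY R n g)) (x R n g : ChartXY R n g) := by
  rw [y_val, x_val, Chart.hom_y_pow, ← IsScalarTower.algebraMap_eq]

theorem isReduction {p : ℕ} {τ : R →+* S} (H : IsReduction p τ) (hn : n ≠ 0) {g' : S[X]}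
    (φ : ChartXY R n g →+* ChartXY S n g')
    (hc : ∀ c : R, φ (algebraMap R _ c) = algebraMap S _ (τ c))
    (hx : φ (x R n g) = x S n g') (hy : φ (y R n g) = y S n g') (hg : g.map τ = g') :
    IsReduction p φ := by
  have h0 : (Chart.y S n g') ^ n =
      g.eval₂ ((algebraMap S (Chart S n g')).comp τ) (Chart.x S n g') := by
    rw [Chart.y_pow, ← hg, eval₂_map]
  refine (Chart.isReduction H hn (Chart.lift _ _ _ h0) (fun c => Chart.lift_const ..)
    (Chart.lift_x ..) (Chart.lift_y ..) hg).localization (Chart.x R n g * Chart.y R n g)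
    (Chart.x S n g' * Chart.y S n g') (by rw [map_mul, Chart.lift_x, Chart.lift_y]) φ ?_
  have : φ.comp (algebraMap (Chart R n g) _) =
      (algebraMap (Chart S n g') _).comp (Chart.lift _ _ _ h0) := by
    refine Chart.hom_ext (fun c => ?_) ?_ ?_
    · simp only [RingHom.comp_apply, Chart.lift_const]
      rw [← IsScalarTower.algebraMap_apply, ← IsScalarTower.algebraMap_apply, hc]
    · simp only [RingHom.comp_apply, Chart.lift_x]
      exact hx
    · simp only [RingHom.comp_apply, Chart.lift_y]
      exact hy
  intro a
  exact congrArg (fun ψ => ψ a) this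

end ChartXY

end Loc

end Charts

/-! ### The curve, its Frobenius twist, and their lifts -/

theorem eval₂_frobenius {p : ℕ} [Fact p.Prime] {k S : Type*} [Field k] [CharP k p] [CommRing S]
    (φ : k →+* S) (a : S) (g : k[X]) :
    (g.map (frobenius k p)).eval₂ φ (a ^ p) = g.eval₂ φ a ^ p := by
  rw [← eval₂_pow, ← map_frobenius_expand, map_expand, expand_eq_comp_X_pow, eval₂_comp,
    eval₂_X_pow]

theorem exists_powHom {p : ℕ} (hp : p.Prime) (A : Type*) [CommRing A] (h : (p : A) = 0) :
    ∃ ψ : A →+* A, ∀ a, ψ a = a ^ p := by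
  cases subsingleton_or_nontrivial A
  · exact ⟨RingHom.id A, fun a => Subsingleton.elim _ _⟩
  · have : CharP A p := (CharP.charP_iff_prime_eq_zero hp).2 h
    have : Fact p.Prime := ⟨hp⟩
    exact ⟨frobenius A p, fun a => rfl⟩

theorem natCast_eq_zero_of_algebra (p : ℕ) (k A : Type*) [CommRing k] [CharP k p] [CommRing A]
    [Algebra k A] : (p : A) = 0 := by
  rw [← map_natCast (algebraMap k A), CharP.cast_eq_zero, map_zero]

section Maps

variable {R S : Type*} [CommRing R] [CommRing S] (n : ℕ)

/-- The morphism of coordinate rings given by a morphism of the base rings. -/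
noncomputable def Chart.map (τ : R →+* S) {g : R[X]} {g' : S[X]} (hg : g.map τ = g') :
    Chart R n g →+* Chart S n g' :=
  Chart.lift ((algebraMap S _).comp τ) (x S n g') (y S n g')
    (by rw [y_pow, ← hg, eval₂_map])

/-- The morphism of coordinate rings given by a morphism of the base rings. -/
noncomputable def ChartY.map (τ : R →+* S) {g : R[X]} {g' : S[X]} (hg : g.map τ = g') :
    ChartY R n g →+* ChartY S n g' :=
  ChartY.lift ((algebraMap S _).comp τ) (x S n g') (y S n g')
    (by rw [y_pow, ← hg, eval₂_map])

/-- The morphism of coordinate rings given by a morphism of the base rings. -/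
noncomputable def ChartXY.map (τ : R →+* S) {g : R[X]} {g' : S[X]} (hg : g.map τ = g') :
    ChartXY R n g →+* ChartXY S n g' :=
  ChartXY.lift ((algebraMap S _).comp τ) (x S n g') (y S n g')
    (by rw [y_pow, ← hg, eval₂_map])

theorem Chart.map_const (τ : R →+* S) {g : R[X]} {g' : S[X]} (hg : g.map τ = g') (c : R) :
    Chart.map n τ hg (algebraMap R _ c) = algebraMap S _ (τ c) := Chart.lift_const _ _ _ _ c

theorem Chart.map_x (τ : R →+* S) {g : R[X]} {g' : S[X]} (hg : g.map τ = g') :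
    Chart.map n τ hg (x R n g) = x S n g' := Chart.lift_x ..

theorem Chart.map_y (τ : R →+* S) {g : R[X]} {g' : S[X]} (hg : g.map τ = g') :
    Chart.map n τ hg (y R n g) = y S n g' := Chart.lift_y ..

theorem ChartY.map_const (τ : R →+* S) {g : R[X]} {g' : S[X]} (hg : g.map τ = g') (c : R) :
    ChartY.map n τ hg (algebraMap R _ c) = algebraMap S _ (τ c) := ChartY.lift_const _ _ _ _ c

theorem ChartY.map_x (τ : R →+* S) {g : R[X]} {g' : S[X]} (hg : g.map τ = g') :
    ChartY.map n τ hg (x R n g) = x S n g' := ChartY.lift_x ..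

theorem ChartY.map_y (τ : R →+* S) {g : R[X]} {g' : S[X]} (hg : g.map τ = g') :
    ChartY.map n τ hg (y R n g) = y S n g' := ChartY.lift_y ..

theorem ChartXY.map_const (τ : R →+* S) {g : R[X]} {g' : S[X]} (hg : g.map τ = g') (c : R) :
    ChartXY.map n τ hg (algebraMap R _ c) = algebraMap S _ (τ c) := ChartXY.lift_const _ _ _ _ c

theorem ChartXY.map_x (τ : R →+* S) {g : R[X]} {g' : S[X]} (hg : g.map τ = g') :
    ChartXY.map n τ hg (x R n g) = x S n g' := ChartXY.lift_x ..

theorem ChartXY.map_y (τ : R →+* S) {g : R[X]} {g' : S[X]} (hg : g.map τ = g') :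
    ChartXY.map n τ hg (y R n g) = y S n g' := ChartXY.lift_y ..

end Maps

section RelFrob

variable (p : ℕ) [Fact p.Prime] {k : Type*} [Field k] [CharP k p] (n : ℕ) (g : k[X])

/-- The relative Frobenius: `x ↦ x ^ p`, `y ↦ y ^ p`, identity on constants. -/
noncomputable def Chart.frob : Chart k n (g.map (frobenius k p)) →+* Chart k n g :=
  Chart.lift (algebraMap k _) (x k n g ^ p) (y k n g ^ p)
    (by rw [eval₂_frobenius, ← y_pow, pow_right_comm])

/-- The relative Frobenius: `x ↦ x ^ p`, `y ↦ y ^ p`, identity on constants. -/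
noncomputable def ChartY.frob : ChartY k n (g.map (frobenius k p)) →+* ChartY k n g :=
  ChartY.lift (algebraMap k _) (x k n g ^ p) (y k n g ^ p)
    (by rw [eval₂_frobenius, ← y_pow, Units.val_pow_eq_pow_val, pow_right_comm])

/-- The relative Frobenius: `x ↦ x ^ p`, `y ↦ y ^ p`, identity on constants. -/
noncomputable def ChartXY.frob : ChartXY k n (g.map (frobenius k p)) →+* ChartXY k n g :=
  ChartXY.lift (algebraMap k _) (x k n g ^ p) (y k n g ^ p)
    (by rw [Units.val_pow_eq_pow_val, Units.val_pow_eq_pow_val, eval₂_frobenius, ← y_pow,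
      pow_right_comm])

end RelFrob

section Settings

variable (p : ℕ) [Fact p.Prime] {k : Type*} [Field k] [CharP k p] (n : ℕ)

theorem map_sigmaW_redW (f : (W1 p k)[X]) :
    (f.map (sigmaW p k)).map (redW p k) = (f.map (redW p k)).map (frobenius k p) := by
  rw [Polynomial.map_map, Polynomial.map_map]
  congr 1
  ext c
  exact redW_sigmaW p k c

variable [PerfectRing k p]

theorem map_frobenius_symm (g : k[X]) :
    (g.map (frobenius k p)).map ((frobeniusEquiv k p).symm : k →+* k) = g := by
  rw [Polynomial.map_map]
  conv_rhs => rw [← Polynomial.map_id (p := g)]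
  congr 1
  ext c
  exact (frobeniusEquiv k p).symm_apply_apply c

theorem frobenius_symm_apply (c : k) : frobenius k p ((frobeniusEquiv k p).symm c) = c :=
  (frobeniusEquiv k p).apply_symm_apply c

theorem symm_frobenius_apply (c : k) : (frobeniusEquiv k p).symm (frobenius k p c) = c :=
  (frobeniusEquiv k p).symm_apply_apply c

variable (hn : n ≠ 0) (f : (W1 p k)[X])

/-- The affine curve `y ^ n = f(x)` over `W₁`, its twist by `σ`, and their reductions. -/
noncomputable def chartSetting :
    FrobSetting p k (Chart (W1 p k) n (f.map (sigmaW p k)))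
      (Chart k n ((f.map (redW p k)).map (frobenius k p)))
      (Chart (W1 p k) n f) (Chart k n (f.map (redW p k))) where
  red' := Chart.map n (redW p k) (map_sigmaW_redW p f)
  red := Chart.map n (redW p k) rfl
  pr1 := Chart.map n (sigmaW p k) rfl
  pr0 := RingEquiv.ofRingHom (Chart.map n (frobenius k p) rfl)
    (Chart.map n ((frobeniusEquiv k p).symm : k →+* k) (map_frobenius_symm p _))
    (by apply Chart.hom_ext <;> simp [Chart.map_const, Chart.map_x, Chart.map_y])
    (by apply Chart.hom_ext <;> simp [Chart.map_const, Chart.map_x, Chart.map_y])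
  frob := Chart.frob p n _
  isRed' := Chart.isReduction (isReduction_redW p k) hn _ (Chart.map_const n _ _)
    (Chart.map_x n _ _) (Chart.map_y n _ _) (map_sigmaW_redW p f)
  isRed := Chart.isReduction (isReduction_redW p k) hn _ (Chart.map_const n _ _)
    (Chart.map_x n _ _) (Chart.map_y n _ _) rfl
  red'_pr1 a := by
    refine congrArg (fun φ : Chart (W1 p k) n f →+* _ => φ a)
      (Chart.hom_ext (φ := (Chart.map n (redW p k) (map_sigmaW_redW p f)).comp
        (Chart.map n (sigmaW p k) rfl))
        (ψ := (Chart.map n (frobenius k p) rfl).comp (Chart.map n (redW p k) rfl)) ?_ ?_ ?_) <;>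
      simp [Chart.map_const, Chart.map_x, Chart.map_y, redW_sigmaW, frobenius_def]
  frob_pr0 a := by
    obtain ⟨ψ, hψ⟩ := exists_powHom Fact.out (Chart k n (f.map (redW p k)))
      (natCast_eq_zero_of_algebra p k _)
    rw [← hψ]
    refine congrArg (fun φ : Chart k n (f.map (redW p k)) →+* _ => φ a)
      (Chart.hom_ext (φ := (Chart.frob p n _).comp (Chart.map n (frobenius k p) rfl))
        (ψ := ψ) ?_ ?_ ?_) <;>
      simp [hψ, Chart.map_const, Chart.map_x, Chart.map_y, Chart.frob, Chart.lift_const, Chart.lift_x, Chart.lift_y,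
        frobenius_def]
  pr0_const c := Chart.map_const n (frobenius k p) rfl c
  frob_const c := Chart.lift_const ..

/-- The open `y ≠ 0` of `y ^ n = f(x)` over `W₁`, its twist by `σ`, and their reductions. -/
noncomputable def chartYSetting :
    FrobSetting p k (ChartY (W1 p k) n (f.map (sigmaW p k)))
      (ChartY k n ((f.map (redW p k)).map (frobenius k p)))
      (ChartY (W1 p k) n f) (ChartY k n (f.map (redW p k))) where
  red' := ChartY.map n (redW p k) (map_sigmaW_redW p f)
  red := ChartY.map n (redW p k) rfl
  pr1 := ChartY.map n (sigmaW p k) rfl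
  pr0 := RingEquiv.ofRingHom (ChartY.map n (frobenius k p) rfl)
    (ChartY.map n ((frobeniusEquiv k p).symm : k →+* k) (map_frobenius_symm p _))
    (by apply ChartY.hom_ext <;> simp [ChartY.map_const, ChartY.map_x, ChartY.map_y])
    (by apply ChartY.hom_ext <;> simp [ChartY.map_const, ChartY.map_x, ChartY.map_y])
  frob := ChartY.frob p n _
  isRed' := ChartY.isReduction (isReduction_redW p k) hn _ (ChartY.map_const n _ _)
    (ChartY.map_x n _ _) (ChartY.map_y n _ _) (map_sigmaW_redW p f)
  isRed := ChartY.isReduction (isReduction_redW p k) hn _ (ChartY.map_const n _ _)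
    (ChartY.map_x n _ _) (ChartY.map_y n _ _) rfl
  red'_pr1 a := by
    refine congrArg (fun φ : ChartY (W1 p k) n f →+* _ => φ a)
      (ChartY.hom_ext (φ := (ChartY.map n (redW p k) (map_sigmaW_redW p f)).comp
        (ChartY.map n (sigmaW p k) rfl))
        (ψ := (ChartY.map n (frobenius k p) rfl).comp (ChartY.map n (redW p k) rfl)) ?_ ?_ ?_) <;>
      simp [ChartY.map_const, ChartY.map_x, ChartY.map_y, redW_sigmaW, frobenius_def]
  frob_pr0 a := by
    obtain ⟨ψ, hψ⟩ := exists_powHom Fact.out (ChartY k n (f.map (redW p k)))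
      (natCast_eq_zero_of_algebra p k _)
    rw [← hψ]
    refine congrArg (fun φ : ChartY k n (f.map (redW p k)) →+* _ => φ a)
      (ChartY.hom_ext (φ := (ChartY.frob p n _).comp (ChartY.map n (frobenius k p) rfl))
        (ψ := ψ) ?_ ?_ ?_) <;>
      simp [hψ, ChartY.map_const, ChartY.map_x, ChartY.map_y, ChartY.frob, ChartY.lift_const, ChartY.lift_x, ChartY.lift_y,
        frobenius_def]
  pr0_const c := ChartY.map_const n (frobenius k p) rfl c
  frob_const c := ChartY.lift_const ..

/-- The open `x y ≠ 0` of `y ^ n = f(x)` over `W₁`, its twist by `σ`, and their reductions. -/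
noncomputable def chartXYSetting :
    FrobSetting p k (ChartXY (W1 p k) n (f.map (sigmaW p k)))
      (ChartXY k n ((f.map (redW p k)).map (frobenius k p)))
      (ChartXY (W1 p k) n f) (ChartXY k n (f.map (redW p k))) where
  red' := ChartXY.map n (redW p k) (map_sigmaW_redW p f)
  red := ChartXY.map n (redW p k) rfl
  pr1 := ChartXY.map n (sigmaW p k) rfl
  pr0 := RingEquiv.ofRingHom (ChartXY.map n (frobenius k p) rfl)
    (ChartXY.map n ((frobeniusEquiv k p).symm : k →+* k) (map_frobenius_symm p _))
    (by apply ChartXY.hom_ext <;> simp [ChartXY.map_const, ChartXY.map_x, ChartXY.map_y])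
    (by apply ChartXY.hom_ext <;> simp [ChartXY.map_const, ChartXY.map_x, ChartXY.map_y])
  frob := ChartXY.frob p n _
  isRed' := ChartXY.isReduction (isReduction_redW p k) hn _ (ChartXY.map_const n _ _)
    (ChartXY.map_x n _ _) (ChartXY.map_y n _ _) (map_sigmaW_redW p f)
  isRed := ChartXY.isReduction (isReduction_redW p k) hn _ (ChartXY.map_const n _ _)
    (ChartXY.map_x n _ _) (ChartXY.map_y n _ _) rfl
  red'_pr1 a := by
    refine congrArg (fun φ : ChartXY (W1 p k) n f →+* _ => φ a)
      (ChartXY.hom_ext (φ := (ChartXY.map n (redW p k) (map_sigmaW_redW p f)).comp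
        (ChartXY.map n (sigmaW p k) rfl))
        (ψ := (ChartXY.map n (frobenius k p) rfl).comp (ChartXY.map n (redW p k) rfl)) ?_ ?_ ?_) <;>
      simp [ChartXY.map_const, ChartXY.map_x, ChartXY.map_y, redW_sigmaW, frobenius_def]
  frob_pr0 a := by
    obtain ⟨ψ, hψ⟩ := exists_powHom Fact.out (ChartXY k n (f.map (redW p k)))
      (natCast_eq_zero_of_algebra p k _)
    rw [← hψ]
    refine congrArg (fun φ : ChartXY k n (f.map (redW p k)) →+* _ => φ a)
      (ChartXY.hom_ext (φ := (ChartXY.frob p n _).comp (ChartXY.map n (frobenius k p) rfl))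
        (ψ := ψ) ?_ ?_ ?_) <;>
      simp [hψ, ChartXY.map_const, ChartXY.map_x, ChartXY.map_y, ChartXY.frob, ChartXY.lift_const, ChartXY.lift_x, ChartXY.lift_y,
        frobenius_def]
  pr0_const c := ChartXY.map_const n (frobenius k p) rfl c
  frob_const c := ChartXY.lift_const ..

end Settings

/-! ### Restriction to the intersection of the two charts -/

theorem reflect_eval_unit {R S : Type*} [CommRing R] [CommRing S] (φ : R →+* S) {n r : ℕ} {g g' : R[X]}
    (hdeg : g.natDegree ≤ r * n) (hg : reflect (r * n) g = g') (a : Sˣ) (b : S)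
    (h : b ^ n = g'.eval₂ φ (a : S)) :
    (((a⁻¹ ^ r : Sˣ) : S) * b) ^ n = g.eval₂ φ ((a⁻¹ : Sˣ) : S) := by
  let _ : Invertible ((a⁻¹ : Sˣ) : S) := ⟨a, by simp, by simp⟩
  have h1 := eval₂_reflect_mul_pow φ ((a⁻¹ : Sˣ) : S) (r * n) g hdeg
  have h2 : (⅟((a⁻¹ : Sˣ) : S)) = (a : S) := rfl
  rw [← h1, hg, h2, mul_pow, h, ← Units.val_pow_eq_pow_val, ← Units.val_pow_eq_pow_val, ← pow_mul]
  ring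

theorem map_unit_inv {S T : Type*} [CommRing S] [CommRing T] (φ : S →+* T) (u : Sˣ) (w : Tˣ)
    (h : φ u = w) : φ ((u⁻¹ : Sˣ) : S) = ((w⁻¹ : Tˣ) : T) := by
  have : Units.map (φ : S →* T) u = w := Units.ext h
  rw [← this, ← map_inv]
  rfl

section Gluing

variable (R : Type*) [CommRing R] (n : ℕ) (g : R[X])

/-- The restriction of functions from `y ≠ 0` to `x y ≠ 0`. -/
noncomputable def ChartY.toXY : ChartY R n g →ₐ[R] ChartXY R n g where
  toRingHom := ChartY.lift (algebraMap R _) (ChartXY.x R n g) (ChartXY.y R n g) ChartXY.y_pow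
  commutes' := ChartY.lift_const _ _ _ _

theorem ChartY.toXY_x : toXY R n g (x R n g) = ChartXY.x R n g := lift_x _ _ _ ChartXY.y_pow

theorem ChartY.toXY_y : toXY R n g (y R n g) = ChartXY.y R n g := lift_y _ _ _ ChartXY.y_pow

variable {R n g} in
theorem ChartXY.glue_eq {r : ℕ} (hdeg : g.natDegree ≤ r * n) {g' : R[X]}
    (hg : reflect (r * n) g = g') :
    ((((x R n g)⁻¹ ^ r * y R n g : (ChartXY R n g)ˣ)) : ChartXY R n g) ^ n =
      g'.eval₂ (algebraMap R _) (((x R n g)⁻¹ : (ChartXY R n g)ˣ) : ChartXY R n g) := by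
  let _ : Invertible (x R n g : ChartXY R n g) := ⟨((x R n g)⁻¹ : (ChartXY R n g)ˣ), by simp, by simp⟩
  have h1 := eval₂_reflect_mul_pow (algebraMap R _) (x R n g : ChartXY R n g) (r * n) g hdeg
  have h2 : (⅟(x R n g : ChartXY R n g)) = (((x R n g)⁻¹ : (ChartXY R n g)ˣ) : ChartXY R n g) := rfl
  rw [h2, hg, ← y_pow] at h1
  rw [Units.val_mul, mul_pow, ← h1, ← Units.val_pow_eq_pow_val, ← Units.val_pow_eq_pow_val,
    ← pow_mul, inv_pow, mul_comm, mul_assoc, Units.mul_inv, mul_one]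

/-- The restriction of functions from the chart at infinity `z ^ n = s ^ (r n) g(1 / s)` to
`x y ≠ 0`, given by `s ↦ x⁻¹`, `z ↦ x⁻ʳ y`. -/
noncomputable def Chart.glue {r : ℕ} (hdeg : g.natDegree ≤ r * n) {g' : R[X]}
    (hg : reflect (r * n) g = g') : Chart R n g' →ₐ[R] ChartXY R n g where
  toRingHom := Chart.lift (algebraMap R _) ((ChartXY.x R n g)⁻¹ : (ChartXY R n g)ˣ)
    ((ChartXY.x R n g)⁻¹ ^ r * ChartXY.y R n g : (ChartXY R n g)ˣ) (ChartXY.glue_eq hdeg hg)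
  commutes' := Chart.lift_const _ _ _ _

theorem Chart.glue_x {r : ℕ} (hdeg : g.natDegree ≤ r * n) {g' : R[X]}
    (hg : reflect (r * n) g = g') :
    glue R n g hdeg hg (x R n g') = ((ChartXY.x R n g)⁻¹ : (ChartXY R n g)ˣ) :=
  lift_x _ _ _ (ChartXY.glue_eq hdeg hg)

theorem Chart.glue_y {r : ℕ} (hdeg : g.natDegree ≤ r * n) {g' : R[X]}
    (hg : reflect (r * n) g = g') :
    glue R n g hdeg hg (y R n g') =
      ((ChartXY.x R n g)⁻¹ ^ r * ChartXY.y R n g : (ChartXY R n g)ˣ) :=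
  lift_y _ _ _ (ChartXY.glue_eq hdeg hg)

end Gluing

section GluingMap

variable {R S : Type*} [CommRing R] [CommRing S] {n : ℕ} (τ : R →+* S) {g : R[X]} {h : S[X]}
  (hgh : g.map τ = h)

theorem ChartY.toXY_map (a : ChartY R n g) :
    toXY S n h (map n τ hgh a) = ChartXY.map n τ hgh (toXY R n g a) := by
  refine congrArg (fun φ : ChartY R n g →+* _ => φ a)
    (hom_ext (φ := ((toXY S n h : ChartY S n h →+* _)).comp (map n τ hgh))
      (ψ := (ChartXY.map n τ hgh).comp (toXY R n g : ChartY R n g →+* _)) ?_ ?_ ?_) <;>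
    simp [map_const, map_x, map_y, toXY_x, toXY_y, ChartXY.map_const, ChartXY.map_x,
      ChartXY.map_y]

theorem Chart.glue_map {r : ℕ} (hdeg : g.natDegree ≤ r * n) {g' : R[X]}
    (hg : reflect (r * n) g = g') (hdeg' : h.natDegree ≤ r * n) {h' : S[X]}
    (hh : reflect (r * n) h = h') (hgh' : g'.map τ = h') (a : Chart R n g') :
    glue S n h hdeg' hh (map n τ hgh' a) = ChartXY.map n τ hgh (glue R n g hdeg hg a) := by
  have h1 := map_unit_inv (ChartXY.map n τ hgh) _ _ (ChartXY.map_x n τ hgh)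
  refine congrArg (fun φ : Chart R n g' →+* _ => φ a)
    (hom_ext (φ := ((glue S n h hdeg' hh : Chart S n h' →+* _)).comp (map n τ hgh'))
      (ψ := (ChartXY.map n τ hgh).comp (glue R n g hdeg hg : Chart R n g' →+* _)) ?_ ?_ ?_) <;>
    simp [map_const, map_x, map_y, glue_x, glue_y, ChartXY.map_const, ChartXY.map_y, h1]

end GluingMap

section RestrSettings

variable (p : ℕ) [Fact p.Prime] {k : Type*} [Field k] [CharP k p] [PerfectRing k p] (n : ℕ)
  (hn : n ≠ 0) (f : (W1 p k)[X])

theorem chartSetting_red : (chartSetting p n hn f).red = Chart.map n (redW p k) rfl := rfl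

theorem chartSetting_red' :
    (chartSetting p n hn f).red' = Chart.map n (redW p k) (map_sigmaW_redW p f) := rfl

theorem chartSetting_pr1 : (chartSetting p n hn f).pr1 = Chart.map n (sigmaW p k) rfl := rfl

theorem chartYSetting_red : (chartYSetting p n hn f).red = ChartY.map n (redW p k) rfl := rfl

theorem chartYSetting_red' :
    (chartYSetting p n hn f).red' = ChartY.map n (redW p k) (map_sigmaW_redW p f) := rfl

theorem chartYSetting_pr1 : (chartYSetting p n hn f).pr1 = ChartY.map n (sigmaW p k) rfl := rfl

theorem chartXYSetting_red : (chartXYSetting p n hn f).red = ChartXY.map n (redW p k) rfl := rfl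

theorem chartXYSetting_red' :
    (chartXYSetting p n hn f).red' = ChartXY.map n (redW p k) (map_sigmaW_redW p f) := rfl

theorem chartXYSetting_pr1 : (chartXYSetting p n hn f).pr1 = ChartXY.map n (sigmaW p k) rfl := rfl

/-- The restriction from `y ≠ 0` to `x y ≠ 0`. -/
noncomputable def restrU : (chartYSetting p n hn f).Restr (chartXYSetting p n hn f) where
  j1' := (ChartY.toXY (W1 p k) n (f.map (sigmaW p k))).toRingHom
  j0' := ChartY.toXY k n ((f.map (redW p k)).map (frobenius k p))
  j1 := (ChartY.toXY (W1 p k) n f).toRingHom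
  j0 := ChartY.toXY k n (f.map (redW p k))
  red_j1 a := by
    rw [chartYSetting_red, chartXYSetting_red]
    symm
    apply ChartY.toXY_map
  red'_j1' a := by
    rw [chartYSetting_red', chartXYSetting_red']
    symm
    apply ChartY.toXY_map
  pr1_j1 a := by
    rw [chartYSetting_pr1, chartXYSetting_pr1]
    symm
    apply ChartY.toXY_map

variable {r : ℕ} (hdeg : f.natDegree ≤ r * n)

/-- The restriction from the chart at infinity to `x y ≠ 0`. -/
noncomputable def restrV :
    (chartSetting p n hn (reflect (r * n) f)).Restr (chartXYSetting p n hn f) where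
  j1' := (Chart.glue (W1 p k) n (f.map (sigmaW p k)) (natDegree_map_le.trans hdeg)
    (reflect_map ..)).toRingHom
  j0' := Chart.glue k n ((f.map (redW p k)).map (frobenius k p))
    (natDegree_map_le.trans (natDegree_map_le.trans hdeg)) (by rw [reflect_map, reflect_map])
  j1 := (Chart.glue (W1 p k) n f hdeg rfl).toRingHom
  j0 := Chart.glue k n (f.map (redW p k)) (natDegree_map_le.trans hdeg) (reflect_map ..)
  red_j1 a := by
    rw [chartSetting_red, chartXYSetting_red]
    symm
    apply Chart.glue_map
  red'_j1' a := by
    rw [chartSetting_red', chartXYSetting_red']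
    symm
    apply Chart.glue_map
  pr1_j1 a := by
    rw [chartSetting_pr1, chartXYSetting_pr1]
    symm
    apply Chart.glue_map

end RestrSettings

/-! ### The lifts of Frobenius on the two charts -/

theorem IsReduction.isUnit {p : ℕ} {A B : Type*} [CommRing A] [CommRing B] {red : A →+* B}
    (H : IsReduction p red) {a : A} (h : IsUnit (red a)) : IsUnit a := by
  obtain ⟨b, hb⟩ := H.surj ((h.unit⁻¹ : Bˣ) : B)
  have h1 : red (a * b) = red 1 := by rw [map_mul, hb, map_one, IsUnit.mul_val_inv]
  obtain ⟨c, hc⟩ := H.exists_of_red_eq h1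
  refine IsUnit.of_mul_eq_one (b * (1 - p * c)) ?_
  rw [← mul_assoc, hc]
  linear_combination (-c * c) * H.p_sq

theorem IsReduction.mul_eq_zero {p : ℕ} {A B : Type*} [CommRing A] [CommRing B] {red : A →+* B}
    (H : IsReduction p red) {a b : A} (ha : red a = 0) (hb : red b = 0) : a * b = 0 := by
  obtain ⟨a, rfl⟩ := (H.ker _).1 ha
  obtain ⟨b, rfl⟩ := (H.ker _).1 hb
  linear_combination (a * b) * H.p_sq

theorem one_add_pow_of_sq {A : Type*} [CommRing A] {u : A} (hu : u * u = 0) (n : ℕ) :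
    (1 + u) ^ n = 1 + n * u := by
  induction n with
  | zero => simp
  | succ n ih =>
    rw [pow_succ, ih]
    push_cast
    linear_combination n * hu

theorem isUnit_natCast_W1 {p : ℕ} [Fact p.Prime] {k : Type*} [Field k] [CharP k p]
    [PerfectRing k p] {n : ℕ} (h : n.Coprime p) : IsUnit (n : W1 p k) := by
  refine (isReduction_redW p k).isUnit ?_
  rw [map_natCast]
  refine (isUnit_iff_ne_zero).2 fun h0 => ?_
  rw [CharP.cast_eq_zero_iff k p] at h0
  exact (Fact.out : p.Prime).one_lt.ne' (Nat.eq_one_of_dvd_coprimes h h0 dvd_rfl)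

theorem eval₂_add_of_sq {R S : Type*} [CommRing R] [CommRing S] (φ : R →+* S) (q : R[X]) {a u : S}
    (hu : u ^ 2 = 0) : q.eval₂ φ (a + u) = q.eval₂ φ a + (derivative q).eval₂ φ a * u := by
  simp only [eval₂_eq_eval_map]
  rw [eval_add_of_sq_eq_zero _ _ _ hu, derivative_map]

section Error

variable {p : ℕ} [Fact p.Prime] {k : Type*} [Field k] [CharP k p]
  {S S0 : Type*} [CommRing S] [Algebra (W1 p k) S] [CommRing S0] [Algebra k S0]

/-- The element `f^σ(a ^ p) - f(a) ^ p`. -/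
noncomputable def frobError (f : (W1 p k)[X]) (a : S) : S :=
  (f.map (sigmaW p k)).eval₂ (algebraMap _ S) (a ^ p) - f.eval₂ (algebraMap _ S) a ^ p

/-- The element `y ^ p (1 + n⁻¹ (f^σ(a ^ p) - f(a) ^ p) y ^ (-np))`. -/
noncomputable def frobY (n : ℕ) (f : (W1 p k)[X]) (a : S) (y : Sˣ) : S :=
  y ^ p * (1 + algebraMap _ S (Ring.inverse (n : W1 p k)) * frobError f a *
    ((y⁻¹ ^ (n * p) : Sˣ) : S))

/-- The element `a ^ p + p v(a)`, where `v` has coefficients in `k`. -/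
noncomputable def frobS (v : k[X]) (a : S) : S :=
  a ^ p + (mulP p (mapRingHom (redW p k)) v).eval₂ (algebraMap _ S) a

/-- The element `z ^ p + p z ^ p b(a)`, where `b` has coefficients in `k`. -/
noncomputable def frobZ (b : k[X]) (a z : S) : S :=
  z ^ p + z ^ p * (mulP p (mapRingHom (redW p k)) b).eval₂ (algebraMap _ S) a

variable {red : S →+* S0}

theorem red_eval (hred : ∀ c : W1 p k, red (algebraMap _ S c) = algebraMap k S0 (redW p k c))
    (f : (W1 p k)[X]) (a : S) :
    red (f.eval₂ (algebraMap _ S) a) = (f.map (redW p k)).eval₂ (algebraMap k S0) (red a) := by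
  rw [hom_eval₂, eval₂_map]
  congr 1
  ext c
  exact hred c

theorem red_eval_sigma (hred : ∀ c : W1 p k, red (algebraMap _ S c) = algebraMap k S0 (redW p k c))
    (f : (W1 p k)[X]) (a : S) :
    red ((f.map (sigmaW p k)).eval₂ (algebraMap _ S) (a ^ p)) =
      red (f.eval₂ (algebraMap _ S) a ^ p) := by
  rw [red_eval hred, map_pow, map_pow, red_eval hred, map_sigmaW_redW, eval₂_frobenius]

theorem red_frobError (hred : ∀ c : W1 p k, red (algebraMap _ S c) = algebraMap k S0 (redW p k c))
    (f : (W1 p k)[X]) (a : S) : red (frobError f a) = 0 := by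
  rw [frobError, map_sub, red_eval_sigma hred, sub_self]

theorem red_frobY (hred : ∀ c : W1 p k, red (algebraMap _ S c) = algebraMap k S0 (redW p k c))
    (n : ℕ) (f : (W1 p k)[X]) (a : S) (y : Sˣ) :
    red (frobY n f a y) = red y ^ p := by
  simp [frobY, red_frobError hred]

theorem frobY_pow [PerfectRing k p] (hred : ∀ c : W1 p k, red (algebraMap _ S c) = algebraMap k S0 (redW p k c))
    (H : IsReduction p red) {n : ℕ} (hn : n.Coprime p) (f : (W1 p k)[X]) (a : S)
    (y : Sˣ) (h : (y : S) ^ n = f.eval₂ (algebraMap _ S) a) :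
    frobY n f a y ^ n = (f.map (sigmaW p k)).eval₂ (algebraMap _ S) (a ^ p) := by
  have h0 : (n : S) * algebraMap _ S (Ring.inverse (n : W1 p k)) = 1 := by
    rw [← map_natCast (algebraMap (W1 p k) S), ← map_mul,
      Ring.mul_inverse_cancel _ (isUnit_natCast_W1 hn), map_one]
  have h1 : (y : S) ^ (n * p) * ((y⁻¹ ^ (n * p) : Sˣ) : S) = 1 := by
    rw [← Units.val_pow_eq_pow_val, ← Units.val_mul, ← mul_pow, mul_inv_cancel, one_pow,
      Units.val_one]
  have hE := red_frobError hred f a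
  have hE' : (f.map (sigmaW p k)).eval₂ (algebraMap _ S) (a ^ p) =
      (y : S) ^ (n * p) + frobError f a := by
    rw [frobError, ← h, pow_mul]
    ring
  rw [hE', frobY, mul_pow, one_add_pow_of_sq (H.mul_eq_zero (by simp [hE]) (by simp [hE])),
    pow_right_comm, ← pow_mul]
  linear_combination (frobError f a * (y : S) ^ (n * p) * ((y⁻¹ ^ (n * p) : Sˣ) : S)) * h0 +
    frobError f a * h1

theorem red_mulP_eval (hred : ∀ c : W1 p k, red (algebraMap _ S c) = algebraMap k S0 (redW p k c))
    (v : k[X]) (a : S) :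
    red ((mulP p (mapRingHom (redW p k)) v).eval₂ (algebraMap _ S) a) = 0 := by
  rw [red_eval hred, mulP]
  simp only [Polynomial.map_mul, Polynomial.map_natCast, CharP.cast_eq_zero, zero_mul, eval₂_zero]

theorem red_frobS (hred : ∀ c : W1 p k, red (algebraMap _ S c) = algebraMap k S0 (redW p k c))
    (v : k[X]) (a : S) : red (frobS v a) = red a ^ p := by
  rw [frobS, map_add, red_mulP_eval hred, add_zero, map_pow]

theorem red_frobZ (hred : ∀ c : W1 p k, red (algebraMap _ S c) = algebraMap k S0 (redW p k c))
    (b : k[X]) (a z : S) : red (frobZ b a z) = red z ^ p := by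
  rw [frobZ, map_add, map_mul, red_mulP_eval hred, mul_zero, add_zero, map_pow]

/-- The relation `g ^ p - g^σ(s ^ p) = p (v g'^p - n b g ^ p)` which makes `s ↦ s ^ p + p v`,
`z ↦ z ^ p + p z ^ p b` a lift of Frobenius on `z ^ n = g(s)`. -/
def FrobRelation (n : ℕ) (g : (W1 p k)[X]) (v b : k[X]) : Prop :=
  g ^ p - expand _ p (g.map (sigmaW p k)) =
    mulP p (mapRingHom (redW p k))
      (v * derivative (g.map (redW p k)) ^ p - n * b * g.map (redW p k) ^ p)

theorem frobZ_pow [PerfectRing k p] (hred : ∀ c : W1 p k, red (algebraMap _ S c) = algebraMap k S0 (redW p k c))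
    (H : IsReduction p red) {n : ℕ} {g : (W1 p k)[X]} {v b : k[X]}
    (hvb : FrobRelation n g v b) (a z : S) (h : z ^ n = g.eval₂ (algebraMap _ S) a) :
    frobZ b a z ^ n = (g.map (sigmaW p k)).eval₂ (algebraMap _ S) (frobS v a) := by
  have P := (isReduction_redW p k).polynomial
  obtain ⟨v, rfl⟩ := P.surj v
  obtain ⟨b, rfl⟩ := P.surj b
  have hev : ∀ q : (W1 p k)[X], (mulP p (mapRingHom (redW p k)) (mapRingHom (redW p k) q)).eval₂
      (algebraMap _ S) a = p * q.eval₂ (algebraMap _ S) a := by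
    intro q
    rw [P.mulP_red, eval₂_mul, eval₂_natCast]
  have h1 : mapRingHom (redW p k) (v * derivative g ^ p - n * b * g ^ p) =
      mapRingHom (redW p k) v * derivative (g.map (redW p k)) ^ p -
        n * mapRingHom (redW p k) b * g.map (redW p k) ^ p := by
    simp [derivative_map]
  have h2 := congrArg (eval₂ (algebraMap _ S) a) hvb
  rw [← h1, hev, eval₂_sub, expand_eq_comp_X_pow, eval₂_comp, eval₂_X_pow, eval₂_sub, eval₂_mul,
    eval₂_mul, eval₂_mul, eval₂_pow, eval₂_pow, eval₂_natCast] at h2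
  have h3 : (p : S) * (derivative (g.map (sigmaW p k))).eval₂ (algebraMap _ S) (a ^ p) =
      p * (derivative g).eval₂ (algebraMap _ S) a ^ p := by
    rw [derivative_map]
    exact H.mul_congr (red_eval_sigma hred _ a)
  have h5 : (g.map (sigmaW p k)).eval₂ (algebraMap _ S) (a ^ p + p * v.eval₂ (algebraMap _ S) a) =
      (g.map (sigmaW p k)).eval₂ (algebraMap _ S) (a ^ p) +
        (derivative (g.map (sigmaW p k))).eval₂ (algebraMap _ S) (a ^ p) *
          (p * v.eval₂ (algebraMap _ S) a) := by
    refine eval₂_add_of_sq _ _ ?_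
    linear_combination (v.eval₂ (algebraMap _ S) a) ^ 2 * H.p_sq
  have h4 : z ^ p + z ^ p * (p * b.eval₂ (algebraMap _ S) a) =
      z ^ p * (1 + p * b.eval₂ (algebraMap _ S) a) := by ring
  rw [frobZ, frobS, hev, hev, h5, h4, mul_pow, one_add_pow_of_sq, pow_right_comm, h]
  · linear_combination h2 - v.eval₂ (algebraMap _ S) a * h3
  · linear_combination (b.eval₂ (algebraMap _ S) a) ^ 2 * H.p_sq

end Error

section SettingLemmas

variable (p : ℕ) [Fact p.Prime] {k : Type*} [Field k] [CharP k p] [PerfectRing k p] {n : ℕ}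
  (hn : n ≠ 0) (f : (W1 p k)[X])

theorem chartSetting_red_const (c : W1 p k) :
    (chartSetting p n hn f).red (algebraMap _ _ c) = algebraMap k _ (redW p k c) :=
  Chart.map_const n _ rfl c

theorem chartSetting_red_x : (chartSetting p n hn f).red (Chart.x _ n f) =
    (Chart.x k n (f.map (redW p k)) : Chart k n _) := Chart.map_x n _ rfl

theorem chartSetting_red_y : (chartSetting p n hn f).red (Chart.y _ n f) =
    (Chart.y k n (f.map (redW p k)) : Chart k n _) := Chart.map_y n _ rfl

theorem chartSetting_red'_const (c : W1 p k) :
    (chartSetting p n hn f).red' (algebraMap _ _ c) = algebraMap k _ (redW p k c) :=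
  Chart.map_const n _ (map_sigmaW_redW p f) c

theorem chartSetting_red'_x : (chartSetting p n hn f).red' (Chart.x _ n (f.map (sigmaW p k))) =
    (Chart.x k n ((f.map (redW p k)).map (frobenius k p)) : Chart k n _) :=
  Chart.map_x n _ (map_sigmaW_redW p f)

theorem chartSetting_red'_y : (chartSetting p n hn f).red' (Chart.y _ n (f.map (sigmaW p k))) =
    (Chart.y k n ((f.map (redW p k)).map (frobenius k p)) : Chart k n _) :=
  Chart.map_y n _ (map_sigmaW_redW p f)

theorem chartSetting_frob_x : (chartSetting p n hn f).frob (Chart.x k n ((f.map (redW p k)).map (frobenius k p))) =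
    (Chart.x k n (f.map (redW p k)) : Chart k n _) ^ p := by
  change Chart.frob p n _ _ = _
  simp [Chart.frob, Chart.lift_x]

theorem chartSetting_frob_y : (chartSetting p n hn f).frob (Chart.y k n ((f.map (redW p k)).map (frobenius k p))) =
    (Chart.y k n (f.map (redW p k)) : Chart k n _) ^ p := by
  change Chart.frob p n _ _ = _
  simp [Chart.frob, Chart.lift_y]

theorem chartYSetting_red_const (c : W1 p k) :
    (chartYSetting p n hn f).red (algebraMap _ _ c) = algebraMap k _ (redW p k c) :=
  ChartY.map_const n _ rfl c

theorem chartYSetting_red_x : (chartYSetting p n hn f).red (ChartY.x _ n f) =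
    (ChartY.x k n (f.map (redW p k)) : ChartY k n _) := ChartY.map_x n _ rfl

theorem chartYSetting_red_y : (chartYSetting p n hn f).red (ChartY.y _ n f) =
    (ChartY.y k n (f.map (redW p k)) : ChartY k n _) := ChartY.map_y n _ rfl

theorem chartYSetting_red'_const (c : W1 p k) :
    (chartYSetting p n hn f).red' (algebraMap _ _ c) = algebraMap k _ (redW p k c) :=
  ChartY.map_const n _ (map_sigmaW_redW p f) c

theorem chartYSetting_red'_x : (chartYSetting p n hn f).red' (ChartY.x _ n (f.map (sigmaW p k))) =
    (ChartY.x k n ((f.map (redW p k)).map (frobenius k p)) : ChartY k n _) :=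
  ChartY.map_x n _ (map_sigmaW_redW p f)

theorem chartYSetting_red'_y : (chartYSetting p n hn f).red' (ChartY.y _ n (f.map (sigmaW p k))) =
    (ChartY.y k n ((f.map (redW p k)).map (frobenius k p)) : ChartY k n _) :=
  ChartY.map_y n _ (map_sigmaW_redW p f)

theorem chartYSetting_frob_x : (chartYSetting p n hn f).frob (ChartY.x k n ((f.map (redW p k)).map (frobenius k p))) =
    (ChartY.x k n (f.map (redW p k)) : ChartY k n _) ^ p := by
  change ChartY.frob p n _ _ = _
  simp [ChartY.frob, ChartY.lift_x]

theorem chartYSetting_frob_y : (chartYSetting p n hn f).frob (ChartY.y k n ((f.map (redW p k)).map (frobenius k p))) =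
    (ChartY.y k n (f.map (redW p k)) : ChartY k n _) ^ p := by
  change ChartY.frob p n _ _ = _
  simp [ChartY.frob, ChartY.lift_y]

theorem chartXYSetting_red_const (c : W1 p k) :
    (chartXYSetting p n hn f).red (algebraMap _ _ c) = algebraMap k _ (redW p k c) :=
  ChartXY.map_const n _ rfl c

theorem chartXYSetting_red_x : (chartXYSetting p n hn f).red (ChartXY.x _ n f) =
    (ChartXY.x k n (f.map (redW p k)) : ChartXY k n _) := ChartXY.map_x n _ rfl

theorem chartXYSetting_red_y : (chartXYSetting p n hn f).red (ChartXY.y _ n f) =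
    (ChartXY.y k n (f.map (redW p k)) : ChartXY k n _) := ChartXY.map_y n _ rfl

theorem chartXYSetting_red'_const (c : W1 p k) :
    (chartXYSetting p n hn f).red' (algebraMap _ _ c) = algebraMap k _ (redW p k c) :=
  ChartXY.map_const n _ (map_sigmaW_redW p f) c

theorem chartXYSetting_red'_x : (chartXYSetting p n hn f).red' (ChartXY.x _ n (f.map (sigmaW p k))) =
    (ChartXY.x k n ((f.map (redW p k)).map (frobenius k p)) : ChartXY k n _) :=
  ChartXY.map_x n _ (map_sigmaW_redW p f)

theorem chartXYSetting_red'_y : (chartXYSetting p n hn f).red' (ChartXY.y _ n (f.map (sigmaW p k))) =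
    (ChartXY.y k n ((f.map (redW p k)).map (frobenius k p)) : ChartXY k n _) :=
  ChartXY.map_y n _ (map_sigmaW_redW p f)

theorem chartXYSetting_frob_x : (chartXYSetting p n hn f).frob (ChartXY.x k n ((f.map (redW p k)).map (frobenius k p))) =
    (ChartXY.x k n (f.map (redW p k)) : ChartXY k n _) ^ p := by
  change ChartXY.frob p n _ _ = _
  simp [ChartXY.frob, ChartXY.lift_x]

theorem chartXYSetting_frob_y : (chartXYSetting p n hn f).frob (ChartXY.y k n ((f.map (redW p k)).map (frobenius k p))) =
    (ChartXY.y k n (f.map (redW p k)) : ChartXY k n _) ^ p := by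
  change ChartXY.frob p n _ _ = _
  simp [ChartXY.frob, ChartXY.lift_y]

end SettingLemmas

section Lifts

theorem ChartY.isUnit_frobY {p : ℕ} [Fact p.Prime] {k : Type*} [Field k] [CharP k p]
    [PerfectRing k p] {n : ℕ} (hn : n ≠ 0) (f : (W1 p k)[X]) :
    IsUnit (frobY n f (x (W1 p k) n f) (y (W1 p k) n f)) := by
  refine (chartYSetting p n hn f).isRed.isUnit ?_
  rw [red_frobY (chartYSetting_red_const p hn f), chartYSetting_red_y]
  exact (y k n _).isUnit.pow p

theorem ChartXY.isUnit_frobY {p : ℕ} [Fact p.Prime] {k : Type*} [Field k] [CharP k p]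
    [PerfectRing k p] {n : ℕ} (hn : n ≠ 0) (f : (W1 p k)[X]) :
    IsUnit (frobY n f (x (W1 p k) n f : ChartXY (W1 p k) n f) (y (W1 p k) n f)) := by
  refine (chartXYSetting p n hn f).isRed.isUnit ?_
  rw [red_frobY (chartXYSetting_red_const p hn f), chartXYSetting_red_y]
  exact (y k n _).isUnit.pow p

theorem ChartXY.isUnit_frobS {p : ℕ} [Fact p.Prime] {k : Type*} [Field k] [CharP k p]
    [PerfectRing k p] {n : ℕ} (hn : n ≠ 0) (f : (W1 p k)[X]) (v : k[X]) :
    IsUnit (frobS v ((x (W1 p k) n f)⁻¹ : (ChartXY (W1 p k) n f)ˣ).val) := by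
  refine (chartXYSetting p n hn f).isRed.isUnit ?_
  rw [red_frobS (chartXYSetting_red_const p hn f)]
  exact ((Units.isUnit _).map _).pow p

theorem ChartXY.isUnit_frobZ {p : ℕ} [Fact p.Prime] {k : Type*} [Field k] [CharP k p]
    [PerfectRing k p] {n : ℕ} (hn : n ≠ 0) (f : (W1 p k)[X]) (r : ℕ) (b : k[X]) :
    IsUnit (frobZ b ((x (W1 p k) n f)⁻¹ : (ChartXY (W1 p k) n f)ˣ).val
      ((x (W1 p k) n f)⁻¹ ^ r * y (W1 p k) n f : (ChartXY (W1 p k) n f)ˣ).val) := by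
  refine (chartXYSetting p n hn f).isRed.isUnit ?_
  rw [red_frobZ (chartXYSetting_red_const p hn f)]
  exact ((Units.isUnit _).map _).pow p

theorem map_frobS {p : ℕ} [Fact p.Prime] {k : Type*} [Field k] [CharP k p] {S T : Type*}
    [CommRing S] [CommRing T] [Algebra (W1 p k) S] [Algebra (W1 p k) T] (φ : S →ₐ[W1 p k] T)
    (v : k[X]) (a : S) : φ (frobS v a) = frobS v (φ a) := by
  rw [frobS, frobS, map_add, map_pow]
  congr 1
  exact (hom_eval₂ _ _ (φ : S →+* T) _).trans (by rw [AlgHom.comp_algebraMap]; rfl)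

theorem map_frobZ {p : ℕ} [Fact p.Prime] {k : Type*} [Field k] [CharP k p] {S T : Type*}
    [CommRing S] [CommRing T] [Algebra (W1 p k) S] [Algebra (W1 p k) T] (φ : S →ₐ[W1 p k] T)
    (b : k[X]) (a z : S) : φ (frobZ b a z) = frobZ b (φ a) (φ z) := by
  have := map_frobS φ b a
  rw [frobS, frobS, map_add, map_pow, add_right_inj] at this
  rw [frobZ, frobZ, map_add, map_mul, map_pow, this]

theorem map_frobY {p : ℕ} [Fact p.Prime] {k : Type*} [Field k] [CharP k p] {S T : Type*}
    [CommRing S] [CommRing T] [Algebra (W1 p k) S] [Algebra (W1 p k) T] (φ : S →ₐ[W1 p k] T)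
    (n : ℕ) (f : (W1 p k)[X]) (a : S) (y : Sˣ) (w : Tˣ) (hw : φ y = w) :
    φ (frobY n f a y) = frobY n f (φ a) w := by
  have h0 : ∀ (q : (W1 p k)[X]) (a : S),
      φ (q.eval₂ (algebraMap _ S) a) = q.eval₂ (algebraMap _ T) (φ a) := fun q a =>
    (hom_eval₂ _ _ (φ : S →+* T) _).trans (by rw [AlgHom.comp_algebraMap]; rfl)
  have h1 : φ ((y⁻¹ : Sˣ) : S) = ((w⁻¹ : Tˣ) : T) := map_unit_inv (φ : S →+* T) _ _ hw
  simp only [frobY, frobError, map_add, map_mul, map_pow, map_sub, map_one, h0, h1, hw,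
    AlgHom.commutes, Units.val_pow_eq_pow_val]

variable (p : ℕ) [Fact p.Prime] {k : Type*} [Field k] [CharP k p] [PerfectRing k p] {n : ℕ}
  (hn : n ≠ 0) (hnp : n.Coprime p) (f : (W1 p k)[X])

/-- The lift of Frobenius `x ↦ x ^ p`, `y ↦ y ^ p (1 + n⁻¹ (f^σ(x ^ p) - f(x) ^ p) y ^ (-np))` on
`y ≠ 0`. -/
noncomputable def ChartY.FU : ChartY (W1 p k) n (f.map (sigmaW p k)) →+* ChartY (W1 p k) n f :=
  lift (algebraMap (W1 p k) _) (x _ n f ^ p) (isUnit_frobY hn f).unit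
    (by
      rw [IsUnit.unit_spec]
      exact frobY_pow (chartYSetting_red_const p hn f) (chartYSetting p n hn f).isRed hnp f _ _
        y_pow)

theorem ChartY.FU_const (c : W1 p k) : FU p hn hnp f (algebraMap _ _ c) = algebraMap _ _ c :=
  lift_const ..

theorem ChartY.FU_x : FU p hn hnp f (x _ n _) = x _ n f ^ p := lift_x ..

theorem ChartY.FU_y : FU p hn hnp f (y _ n (f.map (sigmaW p k))) =
    frobY n f (x (W1 p k) n f) (y (W1 p k) n f) := lift_y ..

/-- The same lift of Frobenius on `x y ≠ 0`. -/
noncomputable def ChartXY.FU : ChartXY (W1 p k) n (f.map (sigmaW p k)) →+* ChartXY (W1 p k) n f :=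
  lift (algebraMap (W1 p k) _) (x _ n f ^ p) (isUnit_frobY hn f).unit
    (by
      rw [Units.val_pow_eq_pow_val, IsUnit.unit_spec]
      exact frobY_pow (chartXYSetting_red_const p hn f) (chartXYSetting p n hn f).isRed hnp f _ _
        y_pow)

theorem ChartXY.FU_const (c : W1 p k) : FU p hn hnp f (algebraMap _ _ c) = algebraMap _ _ c :=
  lift_const ..

theorem ChartXY.FU_x : FU p hn hnp f (x _ n (f.map (sigmaW p k))) =
    (x _ n f : ChartXY (W1 p k) n f) ^ p := lift_x ..

theorem ChartXY.FU_y : FU p hn hnp f (y _ n (f.map (sigmaW p k))) =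
    frobY n f (x (W1 p k) n f : ChartXY (W1 p k) n f) (y (W1 p k) n f) := lift_y ..

/-- The lift of Frobenius `s ↦ s ^ p + p v(s)`, `z ↦ z ^ p + p z ^ p b(s)` on the curve
`z ^ n = g(s)`. -/
noncomputable def Chart.FV (g : (W1 p k)[X]) (v b : k[X]) (hvb : FrobRelation n g v b) :
    Chart (W1 p k) n (g.map (sigmaW p k)) →+* Chart (W1 p k) n g :=
  lift (algebraMap (W1 p k) _) (frobS v (x _ n g)) (frobZ b (x _ n g) (y _ n g))
    (frobZ_pow (chartSetting_red_const p hn g) (chartSetting p n hn g).isRed hvb _ _ y_pow)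

theorem Chart.FV_const (g : (W1 p k)[X]) (v b : k[X]) (hvb : FrobRelation n g v b) (c : W1 p k) :
    FV p hn g v b hvb (algebraMap _ _ c) = algebraMap _ _ c := lift_const ..

theorem Chart.FV_x (g : (W1 p k)[X]) (v b : k[X]) (hvb : FrobRelation n g v b) :
    FV p hn g v b hvb (x _ n _) = frobS v (x _ n g) := lift_x ..

theorem Chart.FV_y (g : (W1 p k)[X]) (v b : k[X]) (hvb : FrobRelation n g v b) :
    FV p hn g v b hvb (y _ n _) = frobZ b (x _ n g) (y _ n g) := lift_y ..

variable {r : ℕ} (hdeg : f.natDegree ≤ r * n)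
  (v b : k[X]) (hvb : FrobRelation n (reflect (r * n) f) v b)

/-- The extension to `x y ≠ 0`, in the coordinates `x = s⁻¹`, `y = s⁻ʳ z`, of the lift of Frobenius
`s ↦ s ^ p + p v(s)`, `z ↦ z ^ p + p z ^ p b(s)` on the chart at infinity. -/
noncomputable def ChartXY.FV :
    ChartXY (W1 p k) n (f.map (sigmaW p k)) →+* ChartXY (W1 p k) n f :=
  lift (algebraMap (W1 p k) _) (isUnit_frobS hn f v).unit⁻¹
    ((isUnit_frobS hn f v).unit⁻¹ ^ r * (isUnit_frobZ hn f r b).unit)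
    (by
      rw [Units.val_mul]
      refine reflect_eval_unit _ (natDegree_map_le.trans hdeg) (reflect_map ..) _ _ ?_
      exact frobZ_pow (chartXYSetting_red_const p hn f) (chartXYSetting p n hn f).isRed hvb _ _
        (glue_eq hdeg rfl))

theorem ChartXY.FV_const (c : W1 p k) :
    FV p hn f hdeg v b hvb (algebraMap _ _ c) = algebraMap _ _ c := lift_const ..

theorem ChartXY.FV_x : FV p hn f hdeg v b hvb (x _ n (f.map (sigmaW p k))) =
    ((isUnit_frobS hn f v).unit⁻¹ : (ChartXY (W1 p k) n f)ˣ) := lift_x ..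

theorem ChartXY.FV_y : FV p hn f hdeg v b hvb (y _ n (f.map (sigmaW p k))) =
    (((isUnit_frobS hn f v).unit⁻¹ ^ r * (isUnit_frobZ hn f r b).unit :
      (ChartXY (W1 p k) n f)ˣ) : ChartXY (W1 p k) n f) := lift_y ..

/-- `ChartY.FU` as a lift of the relative Frobenius. -/
noncomputable def liftU : (chartYSetting p n hn f).Lift where
  F := ChartY.FU p hn hnp f
  red_F a := by
    refine congrArg (fun φ : ChartY (W1 p k) n (f.map (sigmaW p k)) →+* _ => φ a)
      (ChartY.hom_ext (φ := (chartYSetting p n hn f).red.comp (ChartY.FU p hn hnp f))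
        (ψ := (chartYSetting p n hn f).frob.comp (chartYSetting p n hn f).red') ?_ ?_ ?_)
    · intro c
      rw [RingHom.comp_apply, RingHom.comp_apply, ChartY.FU_const,
        chartYSetting_red_const, chartYSetting_red'_const, (chartYSetting p n hn f).frob_const]
    · rw [RingHom.comp_apply, RingHom.comp_apply, ChartY.FU_x, map_pow,
        chartYSetting_red_x, chartYSetting_red'_x, chartYSetting_frob_x]
    · rw [RingHom.comp_apply, RingHom.comp_apply, ChartY.FU_y,
        red_frobY (chartYSetting_red_const p hn f),
        chartYSetting_red_y, chartYSetting_red'_y, chartYSetting_frob_y]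

/-- `ChartXY.FU` as a lift of the relative Frobenius. -/
noncomputable def liftUXY : (chartXYSetting p n hn f).Lift where
  F := ChartXY.FU p hn hnp f
  red_F a := by
    refine congrArg (fun φ : ChartXY (W1 p k) n (f.map (sigmaW p k)) →+* _ => φ a)
      (ChartXY.hom_ext (φ := (chartXYSetting p n hn f).red.comp (ChartXY.FU p hn hnp f))
        (ψ := (chartXYSetting p n hn f).frob.comp (chartXYSetting p n hn f).red') ?_ ?_ ?_)
    · intro c
      rw [RingHom.comp_apply, RingHom.comp_apply, ChartXY.FU_const,
        chartXYSetting_red_const, chartXYSetting_red'_const, (chartXYSetting p n hn f).frob_const]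
    · rw [RingHom.comp_apply, RingHom.comp_apply, ChartXY.FU_x, map_pow, chartXYSetting_red_x, chartXYSetting_red'_x,
        chartXYSetting_frob_x]
    · rw [RingHom.comp_apply, RingHom.comp_apply, ChartXY.FU_y,
        red_frobY (chartXYSetting_red_const p hn f),
        chartXYSetting_red_y, chartXYSetting_red'_y, chartXYSetting_frob_y]

/-- `Chart.FV` as a lift of the relative Frobenius. -/
noncomputable def liftV (g : (W1 p k)[X]) (v b : k[X]) (hvb : FrobRelation n g v b) :
    (chartSetting p n hn g).Lift where
  F := Chart.FV p hn g v b hvb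
  red_F a := by
    refine congrArg (fun φ : Chart (W1 p k) n (g.map (sigmaW p k)) →+* _ => φ a)
      (Chart.hom_ext (φ := (chartSetting p n hn g).red.comp (Chart.FV p hn g v b hvb))
        (ψ := (chartSetting p n hn g).frob.comp (chartSetting p n hn g).red') ?_ ?_ ?_)
    · intro c
      rw [RingHom.comp_apply, RingHom.comp_apply, Chart.FV_const,
        chartSetting_red_const, chartSetting_red'_const, (chartSetting p n hn g).frob_const]
    · rw [RingHom.comp_apply, RingHom.comp_apply, Chart.FV_x,
        red_frobS (chartSetting_red_const p hn g),
        chartSetting_red_x, chartSetting_red'_x, chartSetting_frob_x]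
    · rw [RingHom.comp_apply, RingHom.comp_apply, Chart.FV_y,
        red_frobZ (chartSetting_red_const p hn g),
        chartSetting_red_y, chartSetting_red'_y, chartSetting_frob_y]

/-- `ChartXY.FV` as a lift of the relative Frobenius. -/
noncomputable def liftVXY : (chartXYSetting p n hn f).Lift where
  F := ChartXY.FV p hn f hdeg v b hvb
  red_F a := by
    have h1 : (chartXYSetting p n hn f).red (frobS v ((ChartXY.x (W1 p k) n f)⁻¹ :
        (ChartXY (W1 p k) n f)ˣ).val) =
        (((ChartXY.x k n (f.map (redW p k)))⁻¹ ^ p : (ChartXY k n (f.map (redW p k)))ˣ) :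
          ChartXY k n (f.map (redW p k))) := by
      rw [red_frobS (chartXYSetting_red_const p hn f),
        map_unit_inv _ _ _ (chartXYSetting_red_x p hn f), Units.val_pow_eq_pow_val]
    have h2 : (chartXYSetting p n hn f).red ((ChartXY.isUnit_frobS hn f v).unit⁻¹ :
        (ChartXY (W1 p k) n f)ˣ).val = (ChartXY.x k n (f.map (redW p k))).val ^ p := by
      rw [map_unit_inv _ _ _ h1, inv_pow, inv_inv, Units.val_pow_eq_pow_val]
    refine congrArg (fun φ : ChartXY (W1 p k) n (f.map (sigmaW p k)) →+* _ => φ a)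
      (ChartXY.hom_ext (φ := (chartXYSetting p n hn f).red.comp (ChartXY.FV p hn f hdeg v b hvb))
        (ψ := (chartXYSetting p n hn f).frob.comp (chartXYSetting p n hn f).red') ?_ ?_ ?_)
    · intro c
      rw [RingHom.comp_apply, RingHom.comp_apply, ChartXY.FV_const,
        chartXYSetting_red_const, chartXYSetting_red'_const, (chartXYSetting p n hn f).frob_const]
    · rw [RingHom.comp_apply, RingHom.comp_apply, ChartXY.FV_x, h2,
        chartXYSetting_red'_x, chartXYSetting_frob_x]
    · rw [RingHom.comp_apply, RingHom.comp_apply, ChartXY.FV_y, Units.val_mul,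
        Units.val_pow_eq_pow_val, map_mul, map_pow, h2, IsUnit.unit_spec,
        red_frobZ (chartXYSetting_red_const p hn f), Units.val_mul, map_mul, chartXYSetting_red_y,
        Units.val_pow_eq_pow_val, map_pow, map_unit_inv _ _ _ (chartXYSetting_red_x p hn f),
        chartXYSetting_red'_y, chartXYSetting_frob_y, mul_pow, ← mul_assoc, ← pow_mul, ← pow_mul,
        mul_comm r p, ← mul_pow _ _ (p * r), Units.mul_inv, one_pow, one_mul]

/-- The lift of Frobenius on `y ≠ 0`, with its restriction to `x y ≠ 0`. -/
noncomputable def frobU : (restrU p n hn f).Lift where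
  big := liftU p hn hnp f
  small := liftUXY p hn hnp f
  compat a := by
    refine congrArg (fun φ : ChartY (W1 p k) n (f.map (sigmaW p k)) →+* _ => φ a)
      (ChartY.hom_ext (φ := (ChartXY.FU p hn hnp f).comp
          (ChartY.toXY (W1 p k) n (f.map (sigmaW p k))).toRingHom)
        (ψ := (ChartY.toXY (W1 p k) n f).toRingHom.comp (ChartY.FU p hn hnp f)) ?_ ?_ ?_)
    · intro c
      simp [ChartXY.FU_const, ChartY.FU_const]
    · simp [ChartXY.FU_x, ChartY.FU_x, ChartY.toXY_x]
    · simp only [AlgHom.toRingHom_eq_coe, RingHom.comp_apply, RingHom.coe_coe, ChartY.toXY_y,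
        ChartXY.FU_y, ChartY.FU_y]
      rw [map_frobY _ _ _ _ _ _ (ChartY.toXY_y _ _ _), ChartY.toXY_x]

/-- The lift of Frobenius on the chart at infinity, with its restriction to `x y ≠ 0`. -/
noncomputable def frobV : (restrV p n hn f hdeg).Lift where
  big := liftV p hn _ v b hvb
  small := liftVXY p hn f hdeg v b hvb
  compat a := by
    have h1 : ChartXY.FV p hn f hdeg v b hvb
        ((ChartXY.x (W1 p k) n (f.map (sigmaW p k)))⁻¹ : (ChartXY (W1 p k) n _)ˣ).val =
        frobS v ((ChartXY.x (W1 p k) n f)⁻¹ : (ChartXY (W1 p k) n f)ˣ).val := by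
      rw [map_unit_inv _ _ (ChartXY.isUnit_frobS hn f v).unit⁻¹ (by rw [ChartXY.FV_x]),
        inv_inv, IsUnit.unit_spec]
    refine congrArg
      (fun φ : Chart (W1 p k) n ((reflect (r * n) f).map (sigmaW p k)) →+* _ => φ a)
      (Chart.hom_ext (φ := (ChartXY.FV p hn f hdeg v b hvb).comp
          (Chart.glue (W1 p k) n (f.map (sigmaW p k)) (natDegree_map_le.trans hdeg)
            (reflect_map ..)).toRingHom)
        (ψ := (Chart.glue (W1 p k) n f hdeg rfl).toRingHom.comp
          (Chart.FV p hn _ v b hvb)) ?_ ?_ ?_)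
    · intro c
      simp [ChartXY.FV_const, Chart.FV_const]
    · simp only [AlgHom.toRingHom_eq_coe, RingHom.comp_apply, RingHom.coe_coe, Chart.glue_x,
        Chart.FV_x, h1, map_frobS]
    · simp only [AlgHom.toRingHom_eq_coe, RingHom.comp_apply, RingHom.coe_coe, Chart.glue_x,
        Chart.glue_y, Chart.FV_y, map_frobZ]
      rw [Units.val_mul, Units.val_pow_eq_pow_val, map_mul, map_pow, h1, ChartXY.FV_y, Units.val_mul, ← mul_assoc, Units.val_pow_eq_pow_val, ← mul_pow,
        IsUnit.mul_val_inv, one_pow, one_mul, IsUnit.unit_spec]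

end Lifts

/-! ### The superelliptic curve and its divided Frobenius -/

/-- The form `x ^ i y ^ (-j) dx` on the open `y ≠ 0`. -/
noncomputable def ChartY.omega (k : Type*) [CommRing k] (n : ℕ) (g : k[X]) (i j : ℕ) :
    Ω[ChartY k n g⁄k] :=
  (x k n g ^ i * (((y k n g)⁻¹ ^ j : (ChartY k n g)ˣ) : ChartY k n g)) •
    KaehlerDifferential.D k (ChartY k n g) (x k n g)

/-- The form `x ^ i y ^ (-j) dx` on the open `x y ≠ 0`. -/
noncomputable def ChartXY.omega (k : Type*) [CommRing k] (n : ℕ) (g : k[X]) (i j : ℕ) :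
    Ω[ChartXY k n g⁄k] :=
  ((x k n g ^ i * (y k n g)⁻¹ ^ j : (ChartXY k n g)ˣ) : ChartXY k n g) •
    KaehlerDifferential.D k (ChartXY k n g) (x k n g)

/-- The function `x ^ (-m) y ^ e` on the open `x y ≠ 0`. -/
noncomputable def ChartXY.monomial (k : Type*) [CommRing k] (n : ℕ) (g : k[X]) (m e : ℕ) :
    ChartXY k n g :=
  (((x k n g)⁻¹ ^ m * y k n g ^ e : (ChartXY k n g)ˣ) : ChartXY k n g)

/-- The data defining the superelliptic curve `y ^ n = f(t)` over `W = W(k)`: an integer `n` prime to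
`p`, an integer `l = r n - 1` which is not a multiple of `p`, and a polynomial `f ∈ W[t]` of degree
`l`, whose degree does not drop modulo `p`, which generates the unit ideal together with its
derivative, and whose reduction modulo `p` is prime to `t`. -/
structure CurveData (p : ℕ) [Fact p.Prime] (k : Type*) [Field k] [CharP k p] where
  n : ℕ
  l : ℕ
  r : ℕ
  coprime_n : n.Coprime p
  l_add_one : l + 1 = r * n
  not_dvd_l : ¬ p ∣ l
  f : (WittVector p k)[X]
  natDegree_f : f.natDegree = l
  natDegree_f_mod : (f.map WittVector.constantCoeff).natDegree = l
  isCoprime_derivative : IsCoprime f (derivative f)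
  isCoprime_X : IsCoprime X (f.map (WittVector.constantCoeff : WittVector p k →+* k))

namespace CurveData

variable {p : ℕ} [Fact p.Prime] {k : Type*} [Field k] [CharP k p] (D : CurveData p k)

theorem n_ne_zero : D.n ≠ 0 := by
  intro h
  have := D.l_add_one
  rw [h] at this
  omega

/-- The polynomial `f` modulo `p²`. -/
noncomputable def f₁ : (W1 p k)[X] := D.f.map (Ideal.Quotient.mk _)

theorem natDegree_f₁_le : D.f₁.natDegree ≤ D.r * D.n := by
  refine natDegree_map_le.trans ?_
  rw [D.natDegree_f, ← D.l_add_one]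
  exact Nat.le_succ _

/-- The polynomial `f` modulo `p`. -/
noncomputable abbrev f₀ : k[X] := D.f₁.map (redW p k)

theorem f₀_eq : D.f₀ = D.f.map WittVector.constantCoeff := by
  rw [f₀, f₁, Polynomial.map_map]
  rfl

/-- The polynomial `f₂(s) = s ^ (r n) f(1 / s)` modulo `p²`. -/
noncomputable abbrev f₂ : (W1 p k)[X] := reflect (D.r * D.n) D.f₁

variable [PerfectRing k p]

/-- The restriction of functions from the open `Ū = {y ≠ 0}` of the chart `y ^ n = f(t)` to its
intersection with the chart at infinity `V`. -/
noncomputable abbrev resU :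
    (chartYSetting p D.n D.n_ne_zero D.f₁).Restr (chartXYSetting p D.n D.n_ne_zero D.f₁) :=
  restrU p D.n D.n_ne_zero D.f₁

/-- The restriction of functions from the chart at infinity `V`, given by `z ^ n = f₂(s)`, to its
intersection with `Ū`. -/
noncomputable abbrev resV :
    (chartSetting p D.n D.n_ne_zero D.f₂).Restr (chartXYSetting p D.n D.n_ne_zero D.f₁) :=
  restrV p D.n D.n_ne_zero D.f₁ D.natDegree_f₁_le

/-- `H⁰(X₀, Ω¹)`, as pairs of forms on `Ū` and `V`. -/
abbrev H0 : Type _ := H0Omega D.resU.j0 D.resV.j0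

/-- `H¹(X₀, O)`. -/
abbrev H1 : Type _ := H1O D.resU.j0 D.resV.j0

/-- `H¹_DR(X₀)`. -/
abbrev HdR : Type _ := H1dR D.resU.j0 D.resV.j0

/-- The polynomials `v` and `b` satisfy the relation
`f₂(s) ^ p - f₂^σ(s ^ p) = p (v f₂'^p - n b f₂ ^ p)` in `W₁[s]`. -/
abbrev Relation (v b : k[X]) : Prop := FrobRelation D.n D.f₂ v b

/-- The lift of Frobenius on `Ū`: `t ↦ t ^ p`,
`y ↦ y ^ p (1 + n⁻¹ (f^σ(t ^ p) - f(t) ^ p) y ^ (-np))`. -/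
noncomputable abbrev FU : D.resU.Lift := frobU p D.n_ne_zero D.coprime_n D.f₁

variable {v b : k[X]}

/-- The lift of Frobenius on `V`: `s ↦ s ^ p + p v(s)`, `z ↦ z ^ p + p z ^ p b(s)`. -/
noncomputable abbrev FV (hvb : D.Relation v b) : D.resV.Lift :=
  frobV p D.n_ne_zero D.f₁ D.natDegree_f₁_le v b hvb

/-- The divided Frobenius `Φ : H⁰(X₀, Ω¹) ⊕ H¹(X₀, O) → H¹_DR(X₀)`. -/
noncomputable def Phi (hvb : D.Relation v b) : D.H0 × D.H1 →ₛₗ[frobenius k p] D.HdR :=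
  FrobSetting.Phi D.FU (D.FV hvb)

/-- The projection `P₁ : H¹_DR(X₀) → H¹(X₀, O)`. -/
noncomputable def P₁ : D.HdR →ₗ[k] D.H1 := hodgeProj D.resU.j0 D.resV.j0

/-- The class in `H¹(X₀, O)` of a function on `Ū ∩ V`. -/
noncomputable def cls : ChartXY k D.n D.f₀ →ₗ[k] D.H1 := classO D.resU.j0 D.resV.j0

/-- The component `h` of the Deligne-Illusie morphism, from the differential forms on the twist of
`Ū ∩ V` to the functions on `Ū ∩ V`. -/
noncomputable def h (hvb : D.Relation v b) :
    Ω[ChartXY k D.n (D.f₀.map (frobenius k p))⁄k] →ₗ[k] ChartXY k D.n D.f₀ :=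
  FrobSetting.hDI D.FU (D.FV hvb)

/-- The form `ω'_{i,j} = t ^ i y ^ (-j) dt` on the twist of `Ū ∩ V`. -/
noncomputable def omega' (i j : ℕ) : Ω[ChartXY k D.n (D.f₀.map (frobenius k p))⁄k] :=
  ChartXY.omega k D.n (D.f₀.map (frobenius k p)) i j

/-- `ω` is the form `ω_{i,j}`: its restriction to `Ū` is `t ^ i y ^ (-j) dt`. -/
def IsOmega (i j : ℕ) (ω : D.H0) : Prop := ω.1.1 = ChartY.omega k D.n D.f₀ i j

end CurveData


end Superelliptic

namespace Superelliptic

/-! ### Reflected polynomials -/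

/-! The whole formula comes from one computation on the overlap of the two charts. There `t = s⁻¹`,
and since `p² = 0`, `F_V(t) = (s^p + p v(s))⁻¹ = t^p - p t^(2p) v(t⁻¹)`, whereas `F_U(t) = t^p`.
Hence `h(dt) = t^(2p) v(t⁻¹)` (`homotopy_D_x`). Semilinearity along the relative Frobenius then
gives `h(ω'_{i,j}) = t^(p(i+2)) y^(-pj) v(t⁻¹)` (`homotopy_omega`). The values of the lifts on `y`
and `z` never enter; they only matter for the lifts to exist.

It remains to reduce this function modulo functions regular on one of the two opens. Write `p j = a
n + e` and `c = n - e`, so that `y^(-pj) = y^c y^(-n(a+1)) = y^c f^(-(a+1))`. Replacing `f^(-(a+1))`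
by the polynomial `IP` costs a multiple of a power of `t`. That power was chosen large enough to
absorb all the poles of `t^(p(i+2)) v(t⁻¹)`, so the error is a polynomial in `t` times powers of `y`
and `y⁻¹`, regular where `y ≠ 0` (`classO_mul_aeval_inv`). What is left is a combination of
monomials `t^(-m) y^c`: for `m ≤ 0` they are regular where `y ≠ 0`; for `m ≥ r c` they equal `s^(m -
rc) z^c` and are regular at infinity. Only `1 ≤ m ≤ rc - 1` survives (`classO_aeval_inv`).

That `t^i y^(-j) dt` is a global form is a matter of smoothness at infinity. In the other chart it
is `-s^(rj-i-2) z^(-j) ds`, and a Bézout relation between `f₂` and `f₂'` shows that `z^(1-n) ds` is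
regular (`Chart.exists_y_pow_smul_eq`). Coprimality of `f₂` and `f₂'` is deduced from that of `f`
and `f'`, together with `deg f = rn - 1` (`isCoprime_reflect_derivative`). Finally `P₁` reads only
the third entry of the Deligne-Illusie cocycle, so `P₁ ∘ Φ` on such a form is the class of `h(ω')`
(`P₁_Phi`). -/

/-- This is Euler's identity for the homogenization `F(x, s)` of `f` in degree `N`, `N F = x F_x + s
F_s`, read at `x = 1`. It transports common zeros of the reflected polynomial and its derivative
back to common zeros of `f` and `f'`. -/
theorem natCast_mul_reflect_sub {R : Type*} [CommRing R] (N : ℕ) (f : R[X])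
    (hf : f.natDegree ≤ N) :
    (N : R[X]) * reflect N f - X * derivative (reflect N f) = reflect N (X * derivative f) := by
  ext m
  rw [coeff_sub, ← C_eq_natCast, coeff_C_mul, coeff_reflect, coeff_reflect]
  rcases le_or_gt m N with hm | hm
  · obtain ⟨c, rfl⟩ := Nat.exists_eq_add_of_le hm
    rw [revAt_le hm, Nat.add_sub_cancel_left]
    have h1 : (X * derivative (reflect (m + c) f)).coeff m = f.coeff c * m := by
      cases m with
      | zero => simp
      | succ m =>
        rw [coeff_X_mul, coeff_derivative, coeff_reflect, revAt_le hm, Nat.add_sub_cancel_left]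
        push_cast
        rfl
    have h2 : (X * derivative f).coeff c = f.coeff c * c := by
      cases c with
      | zero => simp
      | succ c => rw [coeff_X_mul, coeff_derivative]; push_cast; rfl
    rw [h1, h2]
    push_cast
    ring
  -- Above `N` reflection fixes the index, so every coefficient in sight is a multiple of one
  -- coefficient of `f` beyond its degree.
  · obtain ⟨m, rfl⟩ : ∃ c, m = c + 1 := ⟨m - 1, by omega⟩
    rw [revAt_eq_self_of_lt hm, coeff_X_mul, coeff_X_mul, coeff_derivative, coeff_derivative,
      coeff_reflect, revAt_eq_self_of_lt hm, coeff_eq_zero_of_natDegree_lt (by omega)]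
    simp

theorem eval₂_reflect_eq_zero_iff {R K : Type*} [CommRing R] [Field K] (φ : R →+* K) {N : ℕ}
    {f : R[X]} (hf : f.natDegree ≤ N) {a : K} (ha : a ≠ 0) :
    (reflect N f).eval₂ φ a = 0 ↔ f.eval₂ φ a⁻¹ = 0 := by
  -- Declaring the inverse of `a⁻¹` to be `a` itself makes the reflection formula at `a⁻¹` read, by
  -- definition, as an evaluation of the reflected polynomial at `a`.
  let _ : Invertible a⁻¹ := ⟨a, mul_inv_cancel₀ ha, inv_mul_cancel₀ ha⟩
  rw [← eval₂_reflect_mul_pow φ a⁻¹ N f hf]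
  change _ ↔ eval₂ φ a (reflect N f) * a⁻¹ ^ N = 0
  rw [mul_eq_zero, or_iff_left (pow_ne_zero _ (inv_ne_zero ha))]

/-- If `f` has degree `N - 1` and no multiple root, then neither does `s ^ N f(1 / s)`. -/
theorem isCoprime_reflect_derivative {K : Type*} [Field K] {N : ℕ} {f : K[X]}
    (hN : f.natDegree + 1 = N) (hf0 : f ≠ 0) (hf : IsCoprime f (derivative f)) :
    IsCoprime (reflect N f) (derivative (reflect N f)) := by
  have hle : f.natDegree ≤ N := by omega
  have hle' : (X * derivative f).natDegree ≤ N := by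
    refine natDegree_mul_le.trans ?_
    have := natDegree_derivative_le f
    have := natDegree_X_le (R := K)
    omega
  -- Over an algebraic closure coprimality means having no common root, and the substitution `s =
  -- 1/t` can be made on roots.
  rw [isCoprime_iff_aeval_ne_zero_of_isAlgClosed K (AlgebraicClosure K)] at hf ⊢
  intro a
  by_contra! h
  obtain ⟨h1, h2⟩ := h
  by_cases ha : a = 0
  · subst ha
    -- At `s = 0` the derivative takes the value of the coefficient of `s`, which is the coefficient
    -- of `f` in degree `N - 1`: its leading coefficient, because the degree is exactly `N - 1`. So
    -- `0` is a simple root.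
    rw [← coeff_zero_eq_aeval_zero', coeff_derivative, coeff_reflect, revAt_le (by omega), ← hN,
      zero_add, Nat.add_sub_cancel] at h2
    simp [hf0] at h2
  -- At a nonzero common root Euler's identity leaves the reflection of `X f'` vanishing at `a`, so
  -- `a⁻¹` is a common root of `f` and `f'`.
  · have h3 := congrArg (aeval a) (natCast_mul_reflect_sub N f hle)
    rw [map_sub, map_mul, map_mul, h1, h2, mul_zero, mul_zero, sub_zero] at h3
    have h4 := (eval₂_reflect_eq_zero_iff _ hle' ha).1 h3.symm
    rw [eval₂_mul, eval₂_X] at h4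
    rcases hf a⁻¹ with h | h
    · exact h ((eval₂_reflect_eq_zero_iff _ hle ha).1 h1)
    · exact h ((mul_eq_zero.1 h4).resolve_left (inv_ne_zero ha))

/-! ### Regular differential forms -/

/-- The differential of the equation of the chart; it trades `g'(x) dx` for a multiple of `y^(n-1)`.
-/
theorem Chart.D_y_pow (k : Type*) [CommRing k] (n : ℕ) (g : k[X]) :
    ((n : Chart k n g) * y k n g ^ (n - 1)) • KaehlerDifferential.D k (Chart k n g) (y k n g) =
      aeval (x k n g) (derivative g) • KaehlerDifferential.D k (Chart k n g) (x k n g) := by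
  have h := congrArg (KaehlerDifferential.D k (Chart k n g)) (y_pow (R := k) (n := n) (g := g))
  rw [← aeval_def, Derivation.map_aeval, Derivation.leibniz_pow] at h
  rw [← h, mul_smul, Nat.cast_smul_eq_nsmul]

/-- On a smooth chart `y ^ n = g(x)` the form `y ^ (1 - n) dx` is regular. -/
theorem Chart.exists_y_pow_smul_eq (k : Type*) [CommRing k] {n : ℕ} (hn : n ≠ 0) {g : k[X]}
    (hg : IsCoprime g (derivative g)) :
    ∃ η : Ω[Chart k n g⁄k],
      y k n g ^ (n - 1) • η = KaehlerDifferential.D k (Chart k n g) (x k n g) := by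
  obtain ⟨a, b, hab⟩ := hg
  have h1 := congrArg (aeval (x k n g)) hab
  simp only [map_add, map_mul, map_one] at h1
  have h2 : aeval (x k n g) g = y k n g ^ (n - 1) * y k n g := by
    rw [pow_sub_one_mul hn, y_pow, aeval_def]
  -- Multiply the Bézout relation `a g + b g' = 1` by `dx`. Both `g dx = y^n dx` and `g' dx = n
  -- y^(n-1) dy` are visibly divisible by `y^(n-1)`, and the quotient is this form.
  refine ⟨(aeval (x k n g) a * y k n g) • KaehlerDifferential.D k _ (x k n g) +
    (aeval (x k n g) b * n) • KaehlerDifferential.D k _ (y k n g), ?_⟩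
  have h3 : y k n g ^ (n - 1) • (aeval (x k n g) b * n) •
      KaehlerDifferential.D k (Chart k n g) (y k n g) = aeval (x k n g) b •
        aeval (x k n g) (derivative g) • KaehlerDifferential.D k _ (x k n g) := by
    rw [← D_y_pow, smul_smul, smul_smul]
    congr 1
    ring
  rw [smul_add, h3, smul_smul, smul_smul, ← add_smul]
  conv_rhs => rw [← one_smul (Chart k n g) (KaehlerDifferential.D k _ (x k n g)), ← h1, h2]
  congr 1
  ring

theorem ChartY.resOmega_omega (k : Type*) [CommRing k] (n : ℕ) (g : k[X]) (i j : ℕ) :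
    resOmega (toXY k n g) (omega k n g i j) = ChartXY.omega k n g i j := by
  have h := map_unit_inv (toXY k n g : ChartY k n g →+* ChartXY k n g) _ _ (toXY_y k n g)
  rw [RingHom.coe_coe] at h
  rw [omega, resOmega_smul, resOmega_D, toXY_x, map_mul, map_pow, toXY_x,
    Units.val_pow_eq_pow_val, map_pow, h, ChartXY.omega]
  push_cast
  rfl

theorem ChartXY.D_x_inv (k : Type*) [CommRing k] (n : ℕ) (g : k[X]) :
    KaehlerDifferential.D k (ChartXY k n g) ((x k n g)⁻¹ : (ChartXY k n g)ˣ) =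
      -(((x k n g)⁻¹ ^ 2 : (ChartXY k n g)ˣ) : ChartXY k n g) •
        KaehlerDifferential.D k (ChartXY k n g) (x k n g) := by
  rw [Units.val_pow_eq_pow_val]
  exact Derivation.leibniz_of_mul_eq_one _ (by simp)

/-- The form `x ^ i y ^ (-j) dx` extends to the chart at infinity if that chart is smooth and
`i + 2 ≤ r j`. -/
theorem Chart.exists_resOmega_glue_eq (k : Type*) [CommRing k] {n : ℕ} {g : k[X]}
    {r : ℕ} (hdeg : g.natDegree ≤ r * n) {g' : k[X]} (hg : reflect (r * n) g = g')
    (hg' : IsCoprime g' (derivative g')) {i j : ℕ} (hj : j + 1 ≤ n) (hij : i + 2 ≤ r * j) :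
    ∃ η : Ω[Chart k n g'⁄k],
      resOmega (glue k n g hdeg hg) η = ChartXY.omega k n g i j := by
  obtain ⟨η, hη⟩ := exists_y_pow_smul_eq k (n := n) (by omega) hg'
  -- With `s = x⁻¹` and `z = x⁻ʳ y` one has `x^i y^(-j) dx = -s^(rj-i-2) z^(-j) ds`, and `z^(-j) ds
  -- = z^(n-1-j) η`, where `η` stands for `z^(1-n) ds`. The bounds on `i` and `j` say that both
  -- exponents are nonnegative, so neither subtraction truncates.
  refine ⟨-((x k n g' ^ (r * j - (i + 2)) * y k n g' ^ (n - 1 - j)) • η), ?_⟩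
  have h1 := congrArg (resOmega (glue k n g hdeg hg)) hη
  set z : (ChartXY k n g)ˣ := (ChartXY.x k n g)⁻¹ ^ r * ChartXY.y k n g with hz
  rw [resOmega_smul, resOmega_D, glue_x, ChartXY.D_x_inv, map_pow, glue_y, ← hz] at h1
  -- On the overlap `z` is a unit, so the relation characterizing `η` can be solved for its
  -- restriction.
  have h2 : resOmega (glue k n g hdeg hg) η = ((z⁻¹ ^ (n - 1) : (ChartXY k n g)ˣ) :
      ChartXY k n g) • -(((ChartXY.x k n g)⁻¹ ^ 2 : (ChartXY k n g)ˣ) : ChartXY k n g) •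
        KaehlerDifferential.D k (ChartXY k n g) (ChartXY.x k n g) := by
    rw [← h1, smul_smul, ← Units.val_pow_eq_pow_val, ← Units.val_mul, ← mul_pow, inv_mul_cancel,
      one_pow, Units.val_one, one_smul]
  rw [map_neg, resOmega_smul, h2, map_mul, map_pow, map_pow, glue_x, glue_y, ← hz, ChartXY.omega,
    smul_smul, smul_smul, ← neg_smul, mul_neg, neg_neg]
  congr 1
  -- All coefficients are products of units, so the comparison is one of exponents in the group of
  -- units; `c` and `e` below replace the truncated differences.
  rw [← Units.val_pow_eq_pow_val, ← Units.val_pow_eq_pow_val, ← Units.val_mul, ← Units.val_mul,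
    ← Units.val_mul]
  congr 1
  obtain ⟨c, hc⟩ := Nat.exists_eq_add_of_le hij
  obtain ⟨e, he⟩ := Nat.exists_eq_add_of_le hj
  have e1 : n - 1 - j = e := by omega
  have e2 : n - 1 = e + j := by omega
  have e3 : r * j - (i + 2) = c := by omega
  rw [e1, e2, e3]
  have h3 : z ^ e * z⁻¹ ^ (e + j) = z⁻¹ ^ j := by
    rw [pow_add, ← mul_assoc, ← mul_pow, mul_inv_cancel, one_pow, one_mul]
  have h4 : z⁻¹ ^ j = ChartXY.x k n g ^ (i + 2 + c) * (ChartXY.y k n g)⁻¹ ^ j := by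
    rw [hz, mul_inv, inv_pow, inv_inv, mul_pow, ← pow_mul, hc]
  rw [mul_assoc (_ ^ c), h3, h4]
  have h5 {G : Type _} [CommGroup G] (u w : G) :
      u⁻¹ ^ c * (u ^ (i + 2 + c) * w) * u⁻¹ ^ 2 = u ^ i * w := by
    rw [add_assoc, pow_add, pow_add, inv_pow, inv_pow]
    calc _ = u ^ i * w * (u ^ c * (u ^ c)⁻¹) * (u ^ 2 * (u ^ 2)⁻¹) := by ac_rfl
      _ = _ := by rw [mul_inv_cancel, mul_inv_cancel, mul_one, mul_one]
  exact h5 _ _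

/-! ### The homotopy between the two lifts of Frobenius -/

namespace ChartXY

section Homotopy

variable (p : ℕ) [Fact p.Prime] {k : Type*} [Field k] [CharP k p] [PerfectRing k p] {n : ℕ}
  (hn : n ≠ 0) (hnp : n.Coprime p) (f : (W1 p k)[X]) {r : ℕ} (hdeg : f.natDegree ≤ r * n)
  (v b : k[X]) (hvb : FrobRelation n (reflect (r * n) f) v b)

/-- The lift from infinity sends `x = s⁻¹` to `(s^p + p v(s))⁻¹`, whose expansion stops at first
order because `p² = 0`; the lift from the finite chart sends it to `x^p`. The difference is
therefore `p x^(2p) v(x⁻¹)`. -/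
theorem homotopy_D_x :
    (chartXYSetting p n hn f).homotopy (liftUXY p hn hnp f) (liftVXY p hn f hdeg v b hvb)
      (KaehlerDifferential.D k _ (x k n ((f.map (redW p k)).map (frobenius k p)))) =
    (x k n (f.map (redW p k)) : ChartXY k n _) ^ (2 * p) *
      aeval (((x k n (f.map (redW p k)))⁻¹ : (ChartXY k n _)ˣ) : ChartXY k n _) v := by
  have hred := chartXYSetting_red_const p hn f
  have H := (chartXYSetting p n hn f).isRed
  -- `p v` makes sense modulo `p²` through any lift of `v`; fixing a lift `w` turns it into an
  -- honest product.
  obtain ⟨w, rfl⟩ := (isReduction_redW p k).polynomial.surj v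
  set u := (isUnit_frobS hn f (mapRingHom (redW p k) w)).unit with hu
  set t := x (W1 p k) n f
  set V := w.eval₂ (algebraMap (W1 p k) (ChartXY (W1 p k) n f)) ((t⁻¹ : (ChartXY _ n f)ˣ) : ChartXY _ n f)
    with hV
  have hu1 : (u : ChartXY (W1 p k) n f) = ((t⁻¹ : (ChartXY _ n f)ˣ) : ChartXY _ n f) ^ p + p * V := by
    rw [hu, IsUnit.unit_spec, frobS, (isReduction_redW p k).polynomial.mulP_red, eval₂_mul,
      eval₂_natCast]
  have ht : (t : ChartXY (W1 p k) n f) ^ p * ((t⁻¹ : (ChartXY _ n f)ˣ) : ChartXY _ n f) ^ p = 1 := by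
    rw [← mul_pow, Units.mul_inv, one_pow]
  have hu2 : ((u⁻¹ : (ChartXY (W1 p k) n f)ˣ) : ChartXY (W1 p k) n f) =
      (t : ChartXY (W1 p k) n f) ^ p - p * ((t : ChartXY (W1 p k) n f) ^ (2 * p) * V) := by
    -- Geometric series truncated after the first-order term: the product differs from `1` only by a
    -- multiple of `p²`.
    refine Units.inv_eq_of_mul_eq_one_right ?_
    rw [hu1, two_mul, pow_add]
    linear_combination (1 - p * V * (t : ChartXY (W1 p k) n f) ^ p) * ht -
      (V ^ 2 * (t : ChartXY (W1 p k) n f) ^ p * (t : ChartXY (W1 p k) n f) ^ p) * H.p_sq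
  rw [← chartXYSetting_red'_x p hn f, FrobSetting.homotopy_D]
  change divP p _ (FU p hn hnp f _ - FV p hn f hdeg _ b hvb _) = _
  rw [FU_x, FV_x, ← hu, hu2, sub_sub_cancel, H.divP_mul, map_mul, map_pow,
    chartXYSetting_red_x, hV, red_eval hred, map_unit_inv _ _ _ (chartXYSetting_red_x p hn f)]
  rfl

/-- Semilinearity along the relative Frobenius raises the coefficient `x^i y^(-j)` to the power `p`;
the factor `x^(2p)` coming from `dx` turns `p i` into `p (i + 2)`. -/
theorem homotopy_omega (i j : ℕ) :
    (chartXYSetting p n hn f).homotopy (liftUXY p hn hnp f) (liftVXY p hn f hdeg v b hvb)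
      (omega k n ((f.map (redW p k)).map (frobenius k p)) i j) =
    (x k n (f.map (redW p k)) : ChartXY k n _) ^ (p * (i + 2)) *
      ((y k n (f.map (redW p k)))⁻¹ : (ChartXY k n _)ˣ).val ^ (p * j) *
      aeval (((x k n (f.map (redW p k)))⁻¹ : (ChartXY k n _)ˣ) : ChartXY k n _) v := by
  have h : (y k n (f.map (redW p k)) : ChartXY k n (f.map (redW p k))) ^ p =
      (y k n (f.map (redW p k)) ^ p : (ChartXY k n (f.map (redW p k)))ˣ) := by
    push_cast
    rfl
  rw [omega, LinearMap.map_smulₛₗ, homotopy_D_x, Units.val_mul, Units.val_pow_eq_pow_val,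
    Units.val_pow_eq_pow_val, map_mul, map_pow, map_pow, chartXYSetting_frob_x,
    map_unit_inv _ _ _ ((chartXYSetting_frob_y p hn f).trans h), smul_eq_mul,
    ← inv_pow, Units.val_pow_eq_pow_val]
  ring

end Homotopy

/-! ### Classes in `H¹(O)` of functions on the intersection of the two charts -/

section Classes

variable {k : Type*} [CommRing k] {n r : ℕ} {g g' : k[X]} (hdeg : g.natDegree ≤ r * n)
  (hg : reflect (r * n) g = g')

theorem classO_toXY (a : ChartY k n g) :
    classO (ChartY.toXY k n g) (Chart.glue k n g hdeg hg) (ChartY.toXY k n g a) = 0 := by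
  refine (Submodule.Quotient.mk_eq_zero _).2 ⟨(a, 0), ?_⟩
  simp [cechO]

theorem classO_glue (a : Chart k n g') :
    classO (ChartY.toXY k n g) (Chart.glue k n g hdeg hg) (Chart.glue k n g hdeg hg a) = 0 := by
  -- The Čech differential subtracts its second entry, hence the sign.
  refine (Submodule.Quotient.mk_eq_zero _).2 ⟨(0, -a), ?_⟩
  simp [cechO]

/-- A polynomial in `x` times an element of `k[y, y⁻¹]` extends to `y ≠ 0`. -/
theorem classO_aeval_mul (q : k[X]) (c e : ℕ) :
    classO (ChartY.toXY k n g) (Chart.glue k n g hdeg hg)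
      (aeval (x k n g : ChartXY k n g) q * (y k n g : ChartXY k n g) ^ c *
        ((y k n g)⁻¹ : (ChartXY k n g)ˣ).val ^ e) = 0 := by
  have h := map_unit_inv (ChartY.toXY k n g : ChartY k n g →+* ChartXY k n g) _ _
    (ChartY.toXY_y k n g)
  rw [RingHom.coe_coe] at h
  rw [← h, ← ChartY.toXY_y, ← ChartY.toXY_x, aeval_algHom_apply, ← map_pow, ← map_pow, ← map_mul,
    ← map_mul, classO_toXY]

theorem monomial_eq (m c : ℕ) : monomial k n g m c =
    ((x k n g)⁻¹ : (ChartXY k n g)ˣ).val ^ m * (y k n g : ChartXY k n g) ^ c := by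
  rw [monomial]
  push_cast
  rfl

/-- In the coordinates at infinity `x^(-m) y^c = s^(m - rc) z^c`, which is regular there once the
exponent of `s` is nonnegative. -/
theorem classO_monomial_eq_zero {m c : ℕ} (h : r * c ≤ m) :
    classO (ChartY.toXY k n g) (Chart.glue k n g hdeg hg) (monomial k n g m c) = 0 := by
  obtain ⟨d, rfl⟩ := Nat.exists_eq_add_of_le h
  have : monomial k n g (r * c + d) c =
      Chart.glue k n g hdeg hg (Chart.x k n g' ^ d * Chart.y k n g' ^ c) := by
    rw [map_mul, map_pow, map_pow, Chart.glue_x, Chart.glue_y, monomial_eq, pow_add, pow_mul,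
      Units.val_mul, Units.val_pow_eq_pow_val]
    ring
  rw [this, classO_glue]

theorem x_pow_mul_inv_pow {m e : ℕ} (h : m ≤ e) :
    (x k n g : ChartXY k n g) ^ e * ((x k n g)⁻¹ : (ChartXY k n g)ˣ).val ^ m =
      (x k n g : ChartXY k n g) ^ (e - m) := by
  obtain ⟨d, rfl⟩ := Nat.exists_eq_add_of_le h
  rw [Nat.add_sub_cancel_left, pow_add, mul_right_comm, ← mul_pow, Units.mul_inv, one_pow, one_mul]

theorem x_pow_mul_inv_pow_add (m e : ℕ) :
    (x k n g : ChartXY k n g) ^ e * ((x k n g)⁻¹ : (ChartXY k n g)ˣ).val ^ (e + m) =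
      ((x k n g)⁻¹ : (ChartXY k n g)ˣ).val ^ m := by
  rw [pow_add, ← mul_assoc, ← mul_pow, Units.mul_inv, one_pow, one_mul]

/-- The class of `x ^ e v(x⁻¹) y ^ c` only involves the coefficients of `v` between `e` and
`e + r c`. -/
theorem classO_aeval_inv (v : k[X]) (e c : ℕ) :
    classO (ChartY.toXY k n g) (Chart.glue k n g hdeg hg)
      ((x k n g : ChartXY k n g) ^ e * aeval ((x k n g)⁻¹ : (ChartXY k n g)ˣ).val v *
        (y k n g : ChartXY k n g) ^ c) =
      ∑ m ∈ Finset.Icc 1 (r * c - 1), v.coeff (e + m) •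
        classO (ChartY.toXY k n g) (Chart.glue k n g hdeg hg) (monomial k n g m c) := by
  set φ := classO (ChartY.toXY k n g) (Chart.glue k n g hdeg hg)
  -- A deliberately generous bound: the range must contain the support of `v` and also all indices
  -- strictly between `e` and `e + rc`, even those beyond the degree of `v`.
  have h1 : v.natDegree < e + r * c + v.natDegree + 1 := by omega
  rw [aeval_eq_sum_range' h1, Finset.mul_sum, Finset.sum_mul, map_sum]
  have h2 : ∀ m, φ ((x k n g : ChartXY k n g) ^ e *
      (v.coeff m • ((x k n g)⁻¹ : (ChartXY k n g)ˣ).val ^ m) * (y k n g : ChartXY k n g) ^ c) =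
      v.coeff m • φ ((x k n g : ChartXY k n g) ^ e * ((x k n g)⁻¹ : (ChartXY k n g)ˣ).val ^ m *
        (y k n g : ChartXY k n g) ^ c) := fun m => by
    rw [mul_smul_comm, smul_mul_assoc, map_smul]
  have h3 : ∀ m, φ ((x k n g : ChartXY k n g) ^ e * ((x k n g)⁻¹ : (ChartXY k n g)ˣ).val ^ (e + m) *
      (y k n g : ChartXY k n g) ^ c) = φ (monomial k n g m c) := fun m => by
    rw [x_pow_mul_inv_pow_add, monomial_eq]
  simp only [h2]
  symm
  -- Shifting by `e` embeds the window `1 ≤ m ≤ rc - 1` in the full range of indices; it remains to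
  -- see that the terms outside it have trivial class.
  refine (Finset.sum_congr rfl fun m _ => by rw [← h3]; rfl).trans
    ((Finset.sum_map _ (addLeftEmbedding e) fun m => v.coeff m • φ ((x k n g : ChartXY k n g) ^ e *
      ((x k n g)⁻¹ : (ChartXY k n g)ˣ).val ^ m * (y k n g : ChartXY k n g) ^ c)).symm.trans
      (Finset.sum_subset ?_ ?_))
  · intro m hm
    rw [Finset.map_add_left_Icc, Finset.mem_Icc] at hm
    rw [Finset.mem_range]
    omega
  · intro m _ hm
    rw [Finset.map_add_left_Icc, Finset.mem_Icc] at hm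
    -- Below the window the term is a polynomial in `x` times `y^c`, regular where `y ≠ 0`; above
    -- it, it extends to the chart at infinity.
    rcases le_or_gt m e with h | h
    · have := classO_aeval_mul hdeg hg (X ^ (e - m)) c 0
      rw [map_pow, aeval_X, pow_zero, mul_one] at this
      rw [x_pow_mul_inv_pow h, this, smul_zero]
    · obtain ⟨d, rfl⟩ := Nat.exists_eq_add_of_le h.le
      rw [h3, classO_monomial_eq_zero hdeg hg (by omega), smul_zero]

/-- The class of `x ^ e y ^ (-s) v(x⁻¹)`, in terms of an approximate inverse `q` of
`g ^ a = y ^ (n a)`. -/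
theorem classO_mul_aeval_inv (v q : k[X]) {a c d e s : ℕ} (hs : s + c = n * a)
    (hq : X ^ d ∣ g ^ a * q - 1) (hd : v.natDegree ≤ e + d) :
    classO (ChartY.toXY k n g) (Chart.glue k n g hdeg hg)
      ((x k n g : ChartXY k n g) ^ e * ((y k n g)⁻¹ : (ChartXY k n g)ˣ).val ^ s *
        aeval ((x k n g)⁻¹ : (ChartXY k n g)ˣ).val v) =
      ∑ m ∈ Finset.Icc 1 (r * c - 1),
        (∑ κ ∈ Finset.range (q.natDegree + 1), q.coeff κ * v.coeff (e + κ + m)) •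
        classO (ChartY.toXY k n g) (Chart.glue k n g hdeg hg) (monomial k n g m c) := by
  -- `x^d w` is the error made when `q` is used as an inverse of `g^a`; on the curve `g^a` is
  -- `y^(na)`.
  obtain ⟨w, hw⟩ := hq
  have hw1 := congrArg (aeval (x k n g : ChartXY k n g)) hw
  rw [map_sub, map_one, map_mul, map_mul, map_pow, map_pow, aeval_X, aeval_def (x k n g : ChartXY k n g) g, ← y_pow,
    ← pow_mul] at hw1
  have hy : (y k n g : ChartXY k n g) ^ (n * a) * ((y k n g)⁻¹ : (ChartXY k n g)ˣ).val ^ (n * a) =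
      1 := by rw [← mul_pow, Units.mul_inv, one_pow]
  have hy' : (y k n g : ChartXY k n g) ^ c * ((y k n g)⁻¹ : (ChartXY k n g)ˣ).val ^ (n * a) =
      ((y k n g)⁻¹ : (ChartXY k n g)ˣ).val ^ s := by
    rw [← hs, pow_add, mul_left_comm, ← mul_pow, Units.mul_inv, one_pow, mul_one]
  -- The degree bound on `v` enters here: the factor `x^d` of the error clears the poles left in
  -- `x^e v(x⁻¹)`, producing a polynomial in `x`.
  have hv : (x k n g : ChartXY k n g) ^ (e + d) * aeval ((x k n g)⁻¹ : (ChartXY k n g)ˣ).val v =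
      aeval (x k n g : ChartXY k n g) (reflect (e + d) v) := by
    let _ : Invertible ((x k n g)⁻¹ : (ChartXY k n g)ˣ).val := ⟨x k n g, by simp, by simp⟩
    have h := eval₂_reflect_mul_pow (algebraMap k (ChartXY k n g))
      ((x k n g)⁻¹ : (ChartXY k n g)ˣ).val (e + d) v hd
    rw [aeval_def, ← h, mul_comm, mul_assoc, ← mul_pow, Units.inv_mul, one_pow, mul_one]
    rfl
  -- Multiply by `1 = g^a q - x^d w` and write `y^(-s) = y^c y^(-na)`. In the first term `g^a`
  -- cancels `y^(-na)`; the second is a polynomial in `x` times powers of `y` and `y⁻¹`, so its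
  -- class vanishes.
  have key : (x k n g : ChartXY k n g) ^ e * ((y k n g)⁻¹ : (ChartXY k n g)ˣ).val ^ s *
        aeval ((x k n g)⁻¹ : (ChartXY k n g)ˣ).val v =
      aeval (x k n g : ChartXY k n g) q * ((x k n g : ChartXY k n g) ^ e *
        aeval ((x k n g)⁻¹ : (ChartXY k n g)ˣ).val v * (y k n g : ChartXY k n g) ^ c) -
      aeval (x k n g : ChartXY k n g) (reflect (e + d) v * w) * (y k n g : ChartXY k n g) ^ c *
        ((y k n g)⁻¹ : (ChartXY k n g)ˣ).val ^ (n * a) := by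
    rw [map_mul, ← hv, ← hy', pow_add]
    linear_combination (-(x k n g : ChartXY k n g) ^ e * (y k n g : ChartXY k n g) ^ c *
      ((y k n g)⁻¹ : (ChartXY k n g)ˣ).val ^ (n * a) *
      aeval ((x k n g)⁻¹ : (ChartXY k n g)ˣ).val v) * hw1 +
      (x k n g : ChartXY k n g) ^ e * (y k n g : ChartXY k n g) ^ c *
      aeval ((x k n g)⁻¹ : (ChartXY k n g)ˣ).val v * aeval (x k n g : ChartXY k n g) q * hy
  rw [key, map_sub, classO_aeval_mul, sub_zero, aeval_eq_sum_range, Finset.sum_mul, map_sum]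
  simp only [Finset.sum_smul, mul_smul]
  -- With `κ` as outer index, the monomial `x^κ` of `q` just shifts `e` to `e + κ` in
  -- `classO_aeval_inv`.
  rw [Finset.sum_comm]
  refine Finset.sum_congr rfl fun κ _ => ?_
  rw [← Finset.smul_sum, ← classO_aeval_inv, smul_mul_assoc, map_smul, pow_add]
  congr 2
  ring

end Classes

end ChartXY

/-! ### The divided Frobenius on `H⁰(Ω¹)` -/

/-- The projection from the twist acts by Frobenius on constants and fixes the coordinate functions,
and the form involves only coordinates. -/
theorem FrobSetting.prOmega_omega (p : ℕ) [Fact p.Prime] {k : Type*} [Field k] [CharP k p]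
    [PerfectRing k p] {n : ℕ} (hn : n ≠ 0) (f : (W1 p k)[X]) (i j : ℕ) :
    (chartXYSetting p n hn f).prOmega (ChartXY.omega k n (f.map (redW p k)) i j) =
      ChartXY.omega k n ((f.map (redW p k)).map (frobenius k p)) i j := by
  have hx : (chartXYSetting p n hn f).pr0 (ChartXY.x k n (f.map (redW p k))) =
      (ChartXY.x k n ((f.map (redW p k)).map (frobenius k p)) : ChartXY k n _) :=
    ChartXY.map_x n (frobenius k p) rfl
  have hy' : (chartXYSetting p n hn f).pr0 (ChartXY.y k n (f.map (redW p k))) =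
      (ChartXY.y k n ((f.map (redW p k)).map (frobenius k p)) : ChartXY k n _) :=
    ChartXY.map_y n (frobenius k p) rfl
  have hy := map_unit_inv (chartXYSetting p n hn f).pr0.toRingHom _ _ hy'
  change (chartXYSetting p n hn f).pr0 _ = _ at hy
  rw [ChartXY.omega, prOmega_smul, prOmega_D, hx, Units.val_mul, Units.val_pow_eq_pow_val,
    Units.val_pow_eq_pow_val, map_mul, map_pow, map_pow, hx, hy, ChartXY.omega]
  push_cast
  rfl

namespace CurveData

variable {p : ℕ} [Fact p.Prime] {k : Type*} [Field k] [CharP k p] (D : CurveData p k)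

/-- The Bézout relation over `W` reduces modulo `p`, and the degree of the reduction is still `rn -
1`, which is what keeps `0` from being a multiple root of the reflected polynomial. -/
theorem isCoprime_reflect_f₀ :
    IsCoprime (reflect (D.r * D.n) D.f₀) (derivative (reflect (D.r * D.n) D.f₀)) := by
  have h := D.isCoprime_derivative.map (mapRingHom (WittVector.constantCoeff : _ →+* k))
  rw [coe_mapRingHom, ← derivative_map, ← f₀_eq] at h
  refine isCoprime_reflect_derivative ?_ ?_ h
  · rw [f₀_eq, D.natDegree_f_mod, D.l_add_one]
  -- A zero reduction would force `l = 0`, which is divisible by `p`.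
  · intro h0
    have h1 := D.natDegree_f_mod
    rw [← f₀_eq, h0, natDegree_zero] at h1
    exact D.not_dvd_l (h1 ▸ dvd_zero p)

variable [PerfectRing k p]

/-- The component where `y ≠ 0` is prescribed; smoothness at infinity supplies a form there with the
same restriction to the overlap. -/
theorem exists_isOmega {i j : ℕ} (hj : j + 1 ≤ D.n) (hij : i + 2 ≤ D.r * j) :
    ∃ ω : D.H0, D.IsOmega i j ω := by
  have hr : reflect (D.r * D.n) D.f₀ = D.f₂.map (redW p k) := reflect_map ..
  obtain ⟨η, hη⟩ := Chart.exists_resOmega_glue_eq k (n := D.n) (g := D.f₀)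
    (natDegree_map_le.trans D.natDegree_f₁_le) hr (hr ▸ D.isCoprime_reflect_f₀) hj hij
  refine ⟨⟨(ChartY.omega k D.n D.f₀ i j, η), ?_⟩, rfl⟩
  rw [mem_H0Omega]
  exact (ChartY.resOmega_omega ..).trans hη.symm

/-- `P₁` keeps only the third entry of the Deligne-Illusie cocycle, namely `h` applied to the
twisted form restricted to the overlap. Twisting commutes with restriction, so knowing the component
of `ω` on one chart is enough. -/
theorem P₁_Phi {v b : k[X]} (hvb : D.Relation v b) {i j : ℕ} {ω : D.H0} (hω : D.IsOmega i j ω) :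
    D.P₁ (D.Phi hvb (ω, 0)) = D.cls (D.h hvb (D.omega' i j)) := by
  have h1 : D.Phi hvb (ω, 0) =
      FrobSetting.DI1 D.FU (D.FV hvb) (FrobSetting.prH0 D.resU D.resV ω) := by
    -- The `H¹(O)` summand contributes nothing, its argument being zero.
    change FrobSetting.DI1 D.FU (D.FV hvb) (FrobSetting.prH0 D.resU D.resV ω) +
      FrobSetting.DI0 D.resU D.resV (FrobSetting.prH1 D.resU D.resV 0) = _
    rw [map_zero, map_zero, add_zero]
  have h2 : resOmega D.resU.j0' (FrobSetting.prOmega (chartYSetting p D.n D.n_ne_zero D.f₁) ω.1.1) = D.omega' i j := by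
    rw [FrobSetting.prOmega_res, hω]
    exact (congrArg _ (ChartY.resOmega_omega ..)).trans (FrobSetting.prOmega_omega ..)
  rw [h1, ← h2]
  rfl

end CurveData

end Superelliptic

/-! ### The explicit formula for `P₁ ∘ Φ` on holomorphic forms -/

theorem mainTheorem4 (p : ℕ) [Fact p.Prime] (k : Type*) [Field k] [Finite k] [CharP k p]
    (D : Superelliptic.CurveData p k)
    (v b : k[X]) (hvb : D.Relation v b)
    (I : k[X]) (hI : (X : k[X]) ^ (v.natDegree - 2 * p + 1) ∣ D.f₀ * I - 1)
    (i j : ℕ) (hj : 1 ≤ j) (hjn : j ≤ D.n - 1) (hij : i + 2 ≤ D.r * j)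
    (a : ℕ) (ha : a = p * j / D.n) (e : ℕ) (he : e = p * j % D.n)
    (IP : k[X]) (hIP : IP = I ^ (a + 1)) :
    (1 ≤ e ∧ e ≤ D.n - 1) ∧
    (∃ ω : D.H0, D.IsOmega i j ω) ∧
    (∀ ω : D.H0, D.IsOmega i j ω →
      D.P₁ (D.Phi hvb (ω, 0)) = D.cls (D.h hvb (D.omega' i j))) ∧
    D.cls (D.h hvb (D.omega' i j)) =
      ∑ m ∈ Finset.Icc 1 (D.r * (D.n - e) - 1),
        (∑ κ ∈ Finset.range (IP.natDegree + 1), IP.coeff κ * v.coeff (p * (i + 2) + κ + m)) •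
          D.cls (Superelliptic.ChartXY.monomial k D.n D.f₀ m (D.n - e)) := by
  have hep : D.n.Coprime p := D.coprime_n
  have hn0 : 0 < D.n := Nat.pos_of_ne_zero D.n_ne_zero
  have he0 : e ≠ 0 := by
    intro h0
    -- A zero remainder means `n ∣ p j`, hence `n ∣ j` as `n` is prime to `p`; this is impossible
    -- for `1 ≤ j ≤ n - 1`.
    have h1 : D.n ∣ j := hep.dvd_of_dvd_mul_left (Nat.dvd_of_mod_eq_zero (he.symm.trans h0))
    have := Nat.le_of_dvd (by omega) h1
    omega
  have hen : e < D.n := he ▸ Nat.mod_lt _ hn0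
  refine ⟨⟨by omega, by omega⟩, D.exists_isOmega (by omega) hij,
    fun ω hω => D.P₁_Phi hvb hω, ?_⟩
  -- Rounding `p j` up to a multiple of `n` gives `y^(-pj) = y^(n-e) f^(-(a+1))`; hence the power `a
  -- + 1` in `IP` and the exponent `n - e` of `y`.
  have hs : p * j + (D.n - e) = D.n * (a + 1) := by
    have := Nat.div_add_mod (p * j) D.n
    rw [← ha, ← he] at this
    rw [mul_add, mul_one]
    omega
  -- The `(a + 1)`-st power of an approximate inverse inverts `f^(a+1)` to the same order, since `u
  -- - 1` divides `u^(a+1) - 1`.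
  have hq : (X : k[X]) ^ (v.natDegree - 2 * p + 1) ∣ D.f₀ ^ (a + 1) * IP - 1 := by
    rw [hIP, ← mul_pow]
    exact hI.trans (sub_one_dvd_pow_sub_one _ _)
  -- The truncated difference is the `max` in the definition of `d`. Since `p (i + 2) ≥ 2p`, order
  -- `d` would already suffice; the `+ 1` is slack.
  have hd : v.natDegree ≤ p * (i + 2) + (v.natDegree - 2 * p + 1) := by
    have : 2 * p ≤ p * (i + 2) := by rw [mul_comm]; exact Nat.mul_le_mul_left p (by omega)
    omega
  have h := Superelliptic.ChartXY.classO_mul_aeval_inv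
    (natDegree_map_le.trans D.natDegree_f₁_le) (reflect_map ..) v IP hs hq hd
  -- `D.cls` and `D.h` unfold to the general class map and homotopy, so the explicit function can be
  -- substituted directly.
  exact (congrArg D.cls (Superelliptic.ChartXY.homotopy_omega ..)).trans h
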